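/- Let $V$ be a set of $n\ge 1$ points, each with a color from a set $\chi$ of $k=|\chi|$ colors, and let $c(S)$ denote the set of points of color $c$ in $S\subseteq V$. A clustering of $V$ is a partition of $V$ into nonempty clusters. It is fair if every cluster $F$ satisfies $|c_1(F)|:\cdots:|c_k(F)|=|c_1(V)|:\cdots:|c_k(V)|$. For clusterings $\mathcal C,\mathcal C'$ let $\mathrm{dist}(\mathcal C,\mathcal C')$ be the number of unordered pairs of points that lie in a common cluster in exactly one of $\mathcal C,\mathcal C'$. Given clusterings $\mathcal C_1,\dots,\mathcal C_m$ of $V$ ($m\ge 1$) and an integer $\ell\ge 1$, a fair consensus clustering is a fair clustering $\mathcal F^*$ that minimizes $\bigl(\sum_{i=1}^m \mathrm{dist}(\mathcal C_i,\mathcal F)^\ell\bigr)^{1/\ell}$ over all fair clusterings $\mathcal F$. A fair clustering $\mathcal F$ is a $\beta$-approximate fair consensus clustering if $$\Bigl(\sum_{i=1}^m \mathrm{dist}(\mathcal C_i,\mathcal F)^\ell\Bigr)^{1/\ell}\le\beta\,\Bigl(\sum_{i=1}^m \mathrm{dist}(\mathcal C_i,\mathcal F^*)^\ell\Bigr)^{1/\ell}.$$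 Theorem. There is an algorithm that, given $\ell$, the colors of the points and the clusterings $\mathcal C_1,\dots,\mathcal C_m$, computes in $O(m^2|V|^2)$ time a fair clustering $\mathcal F$ that is an $O(|\chi|^{3.8})$-approximate fair consensus clustering for arbitrary color proportions $p_1:p_2:\cdots:p_{|\chi|}$, and an $O(|\chi|^{1.6}\log^{2.8}|\chi|)$-approximate fair consensus clustering if $|\chi|\ge 2$ and all colors have equally many points (the $1:1:\cdots:1$ case). The constants hidden in the $O(\cdot)$ are absolute; in particular they do not depend on $\ell$. Here time is the number of steps of a unit-cost word RAM with registers and finitely many indirectly addressed memory arrays, initially zero outside the input. Each constant load, memory access, arithmetic operation (addition, truncated subtraction, multiplication, integer division and remainder) and comparison is one step, and all numbers computed are smaller than $(n+m+k+\ell)^{e}$ for a constant $e$ that depends only on the algorithm. The clusterings are given, and the output is returned, as arrays of cluster labels (input labels are smaller than $n$). -/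

import Mathlib

open Finset
open scoped Classical

noncomputable section

/-! ## Clusterings, fairness and the consensus objective -/

namespace FairConsensus

/-- A clustering of the points `0, …, n - 1`: a partition into nonempty clusters. -/
abbrev Clustering (n : ℕ) : Type := Finpartition (Finset.univ : Finset (Fin n))

/-- The points `u` and `v` lie in the same cluster of `C`. -/
def Together {n : ℕ} (C : Clustering n) (u v : Fin n) : Prop :=
  ∃ A ∈ C.parts, u ∈ A ∧ v ∈ A

/-- The number of unordered pairs of points that are together in exactly one of `C`, `C'`
(an unordered pair is listed once, with its smaller element first). -/
def dist {n : ℕ} (C C' : Clustering n) : ℕ :=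
  #{q : Fin n × Fin n | q.1 < q.2 ∧
    ((Together C q.1 q.2 ∧ ¬ Together C' q.1 q.2) ∨
      (¬ Together C q.1 q.2 ∧ Together C' q.1 q.2))}

/-- The number of points of color `c` in the set `S`. -/
def colorCount {n k : ℕ} (color : Fin n → Fin k) (c : Fin k) (S : Finset (Fin n)) : ℕ :=
  #{v ∈ S | color v = c}

/-- Every cluster `A` has the global color ratio,
`c₁(A) : ⋯ : c_k(A) = c₁(V) : ⋯ : c_k(V)`, written by cross-multiplication. -/
def IsFair {n k : ℕ} (color : Fin n → Fin k) (F : Clustering n) : Prop :=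
  ∀ A ∈ F.parts, ∀ c c' : Fin k,
    colorCount color c A * colorCount color c' Finset.univ =
      colorCount color c' A * colorCount color c Finset.univ

/-- The `(1 : 1 : ⋯ : 1)` case: all color classes have the same size. -/
def EqualProportion {n k : ℕ} (color : Fin n → Fin k) : Prop :=
  ∀ c c' : Fin k, colorCount color c Finset.univ = colorCount color c' Finset.univ

/-- The `ℓ`-norm objective `(∑ᵢ dist(Cᵢ, F)^ℓ)^(1/ℓ)`. -/
def objective {n m : ℕ} (ℓ : ℕ) (C : Fin m → Clustering n) (F : Clustering n) : ℝ :=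
  (∑ i, (dist (C i) F : ℝ) ^ ℓ) ^ ((1 : ℝ) / (ℓ : ℝ))

/-- `F` is an (optimal) fair consensus clustering of the family `C`. -/
def IsFairConsensus {n m k : ℕ} (ℓ : ℕ) (color : Fin n → Fin k)
    (C : Fin m → Clustering n) (F : Clustering n) : Prop :=
  IsFair color F ∧ ∀ G : Clustering n, IsFair color G → objective ℓ C F ≤ objective ℓ C G

/-- `F` is a `β`-approximate fair consensus clustering of the family `C`.  An optimal one always
exists: there are finitely many clusterings, and a single cluster holding all points is fair. -/
def IsApproxFairConsensus {n m k : ℕ} (ℓ : ℕ) (color : Fin n → Fin k)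
    (C : Fin m → Clustering n) (β : ℝ) (F : Clustering n) : Prop :=
  IsFair color F ∧
    ∀ G : Clustering n, IsFairConsensus ℓ color C G → objective ℓ C F ≤ β * objective ℓ C G

/-- The labels `f` describe the clustering `C`: equal labels exactly for points that are
together. -/
def Represents {n : ℕ} (f : Fin n → ℕ) (C : Clustering n) : Prop :=
  ∀ u v : Fin n, f u = f v ↔ Together C u v

/-! ## The machine model: a unit-cost word RAM -/

/-- The memory of a random access machine: registers `reg 0, reg 1, …`, and memory banks
`bank 0, bank 1, …`, each an array that can be addressed indirectly.  A program names only finitely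
many registers and banks. -/
structure State where
  reg : ℕ → ℕ
  bank : ℕ → ℕ → ℕ

/-- Write a register. -/
def State.setReg (s : State) (d x : ℕ) : State :=
  { s with reg := Function.update s.reg d x }

/-- Write a memory cell. -/
def State.setCell (s : State) (b a x : ℕ) : State :=
  { s with bank := Function.update s.bank b (Function.update (s.bank b) a x) }

/-- The arithmetic of the machine: `sub` is truncated at zero, `div` and `mod` are integer division
and remainder. -/
inductive Op where
  | add
  | sub
  | mul
  | div
  | mod

def Op.eval : Op → ℕ → ℕ → ℕ
  | .add, x, y => x + y
  | .sub, x, y => x - y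
  | .mul, x, y => x * y
  | .div, x, y => x / y
  | .mod, x, y => x % y

/-- The tests of the machine compare two registers. -/
inductive Test where
  | lt (a b : ℕ)
  | eq (a b : ℕ)

def Test.Holds : Test → State → Prop
  | .lt a b, s => s.reg a < s.reg b
  | .eq a b, s => s.reg a = s.reg b

/-- Programs of the machine. -/
inductive Prog where
  /-- no operation -/
  | skip
  /-- `reg d := c` -/
  | const (d c : ℕ)
  /-- `reg d := reg a ∘ reg b` -/
  | op (o : Op) (d a b : ℕ)
  /-- `reg d := bank b [reg a]` -/
  | load (d b a : ℕ)
  /-- `bank b [reg a] := reg d` -/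
  | store (b a d : ℕ)
  | seq (P Q : Prog)
  | ite (c : Test) (P Q : Prog)
  | while (c : Test) (P : Prog)

/-- `Exec W P s t s'`: on a machine whose words hold the numbers below `W`, the program `P` started
in `s` halts in `s'` after exactly `t` steps.  Every elementary instruction and every evaluation of
a test is one step.  An instruction whose result does not fit into a word cannot be executed. -/
inductive Exec (W : ℕ) : Prog → State → ℕ → State → Prop where
  | skip (s : State) : Exec W .skip s 1 s
  | const (s : State) (d c : ℕ) (h : c < W) : Exec W (.const d c) s 1 (s.setReg d c)
  | op (s : State) (o : Op) (d a b : ℕ) (h : o.eval (s.reg a) (s.reg b) < W) :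
      Exec W (.op o d a b) s 1 (s.setReg d (o.eval (s.reg a) (s.reg b)))
  | load (s : State) (d b a : ℕ) (h : s.bank b (s.reg a) < W) :
      Exec W (.load d b a) s 1 (s.setReg d (s.bank b (s.reg a)))
  | store (s : State) (b a d : ℕ) (h : s.reg d < W) :
      Exec W (.store b a d) s 1 (s.setCell b (s.reg a) (s.reg d))
  | seq {P Q : Prog} {s s₁ s₂ : State} {t₁ t₂ : ℕ} (hP : Exec W P s t₁ s₁)
      (hQ : Exec W Q s₁ t₂ s₂) : Exec W (.seq P Q) s (t₁ + t₂) s₂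
  | iteTrue {c : Test} {P Q : Prog} {s s' : State} {t : ℕ} (hc : c.Holds s)
      (hP : Exec W P s t s') : Exec W (.ite c P Q) s (t + 1) s'
  | iteFalse {c : Test} {P Q : Prog} {s s' : State} {t : ℕ} (hc : ¬ c.Holds s)
      (hQ : Exec W Q s t s') : Exec W (.ite c P Q) s (t + 1) s'
  | whileFalse {c : Test} {P : Prog} {s : State} (hc : ¬ c.Holds s) :
      Exec W (.while c P) s 1 s
  | whileTrue {c : Test} {P : Prog} {s s₁ s₂ : State} {t₁ t₂ : ℕ} (hc : c.Holds s)
      (hP : Exec W P s t₁ s₁) (hW : Exec W (.while c P) s₁ t₂ s₂) :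
      Exec W (.while c P) s (t₁ + t₂ + 1) s₂

/-- The input: registers `0, 1, 2, 3` hold the number `n` of points, the number `m` of clusterings,
the number `k` of colors and the exponent `ℓ`; bank `0` holds the colors of the points, and bank `1`
holds at `i * n + v` the label of the point `v` in the `i`-th clustering.  Everything else is
zero. -/
def inputState {n m k : ℕ} (ℓ : ℕ) (color : Fin n → Fin k) (lab : Fin m → Fin n → Fin n) :
    State where
  reg r := if r = 0 then n else if r = 1 then m else if r = 2 then k else if r = 3 then ℓ else 0
  bank b a :=
    if b = 0 then (if h : a < n then (color ⟨a, h⟩ : ℕ) else 0)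
    else if b = 1 then
      (if h : a < m * n then
        (lab (finProdFinEquiv.symm ⟨a, h⟩).1 (finProdFinEquiv.symm ⟨a, h⟩).2 : ℕ) else 0)
    else 0

/-- The output: the label of each point is read from bank `2`. -/
def outputLabels (n : ℕ) (s : State) : Fin n → ℕ := fun v => s.bank 2 v

end FairConsensus

end

/-! Both approximation factors are met by one absolute constant, 176. The output is the input
clustering with the smallest total distance to all inputs, rounded to a fair clustering.

Let $N$ be the gcd of the color class sizes, $P = n/N$, and let $p_c$ be the size of class $c$
divided by $N$. The $p_c$ are coprime, so every fair cluster consists of $t \ge 1$ units, that is,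
of $t p_c$ points of each color $c$ (`IsFair.exists_units`). The rounding gives a cluster of size
$s$ at first $\lfloor s/P \rfloor$ units. It is a candidate for one more if $s \bmod P \ge P/2$. The
remaining units go to the candidates by decreasing size, and open new clusters once no candidate is
left. Each cluster keeps as many of its points as its units have room for, and the other points fill
the free places.

A point whose cluster has color counts $x_c$ disagrees with a fair clustering in at least $E =
\sum_c |x_c - t p_c|$ points, where $t$ is the number of units of its fair cluster
(`imbalance_le_card_disagree`). With $T$ units, $\sum_c |x_c - T p_c|$ points move out of or into
the cluster (`GreedyRounding.card_moved`). This is at most $3E$, or $3E + P$ for a candidate rounded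
down (`imbalance_round_le`). The extra $P$ is paid globally. If some candidate is rounded down, then
no new cluster was opened, and counting units shows that $P$ times the number of such candidates is
at most the sum of the deficits $P - (s \bmod P)$ of all candidates. Since larger candidates were
served first, this survives weighting by cluster size (`sum_mul_le_of_greedy`), and each deficit is
at most $E$. Altogether the rounding costs at most 28 times the distance to any fair clustering
(`GreedyRounding.sum_disagree_le`).

The median is at most as far from the inputs as the average input, so the triangle inequality bounds
its distance to a fair $G$ by three times the mean distance of the inputs to $G$. The power mean
inequality carries this over to the $\ell$-norm with a loss independent of $\ell$
(`objective_le_mul`).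

The program is verified with weakest preconditions and loop invariants. Finding the median takes
$O(m^2n^2)$ steps and rounding $O(n^2)$. -/

noncomputable section

namespace FairConsensus

/-! ## A weakest-precondition calculus for the machine -/

/-- Started in `s`, the program `P` halts, and `Q` holds of its running time and final state. -/
def WP (W : ℕ) (P : Prog) (s : State) (Q : ℕ → State → Prop) : Prop :=
  ∃ t s', Exec W P s t s' ∧ Q t s'

theorem WP.mono {W : ℕ} {P : Prog} {s : State} {Q R : ℕ → State → Prop}
    (h : WP W P s Q) (hQR : ∀ t s', Q t s' → R t s') : WP W P s R :=
  let ⟨t, s', he, hq⟩ := h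
  ⟨t, s', he, hQR t s' hq⟩

section rules

variable {W : ℕ} {s : State} {Q : ℕ → State → Prop}

@[simp] theorem wp_skip : WP W .skip s Q ↔ Q 1 s :=
  ⟨fun ⟨_, _, he, h⟩ => by cases he; exact h, fun h => ⟨_, _, .skip s, h⟩⟩

@[simp] theorem wp_const {d c : ℕ} : WP W (.const d c) s Q ↔ c < W ∧ Q 1 (s.setReg d c) :=
  ⟨fun ⟨_, _, he, h⟩ => by cases he with | const _ _ _ hc => exact ⟨hc, h⟩,
    fun ⟨hc, h⟩ => ⟨_, _, .const s d c hc, h⟩⟩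

@[simp] theorem wp_op {o : Op} {d a b : ℕ} :
    WP W (.op o d a b) s Q ↔ o.eval (s.reg a) (s.reg b) < W ∧
      Q 1 (s.setReg d (o.eval (s.reg a) (s.reg b))) :=
  ⟨fun ⟨_, _, he, h⟩ => by cases he with | op _ _ _ _ _ hc => exact ⟨hc, h⟩,
    fun ⟨hc, h⟩ => ⟨_, _, .op s o d a b hc, h⟩⟩

@[simp] theorem wp_load {d b a : ℕ} :
    WP W (.load d b a) s Q ↔ s.bank b (s.reg a) < W ∧ Q 1 (s.setReg d (s.bank b (s.reg a))) :=
  ⟨fun ⟨_, _, he, h⟩ => by cases he with | load _ _ _ _ hc => exact ⟨hc, h⟩,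
    fun ⟨hc, h⟩ => ⟨_, _, .load s d b a hc, h⟩⟩

@[simp] theorem wp_store {b a d : ℕ} :
    WP W (.store b a d) s Q ↔ s.reg d < W ∧ Q 1 (s.setCell b (s.reg a) (s.reg d)) :=
  ⟨fun ⟨_, _, he, h⟩ => by cases he with | store _ _ _ _ hc => exact ⟨hc, h⟩,
    fun ⟨hc, h⟩ => ⟨_, _, .store s b a d hc, h⟩⟩

@[simp] theorem wp_seq {P P' : Prog} :
    WP W (.seq P P') s Q ↔ WP W P s (fun t s' => WP W P' s' (fun t' => Q (t + t'))) :=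
  ⟨fun ⟨_, _, he, h⟩ => by cases he with | seq h₁ h₂ => exact ⟨_, _, h₁, _, _, h₂, h⟩,
    fun ⟨_, _, h₁, _, _, h₂, h⟩ => ⟨_, _, .seq h₁ h₂, h⟩⟩

@[simp] theorem wp_ite {c : Test} {P P' : Prog} :
    WP W (.ite c P P') s Q ↔ (c.Holds s → WP W P s (fun t => Q (t + 1))) ∧
      (¬ c.Holds s → WP W P' s (fun t => Q (t + 1))) := by
  constructor
  · rintro ⟨_, _, he, h⟩
    cases he with
    | iteTrue hc hP => exact ⟨fun _ => ⟨_, _, hP, h⟩, fun hn => absurd hc hn⟩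
    | iteFalse hc hP => exact ⟨fun hn => absurd hn hc, fun _ => ⟨_, _, hP, h⟩⟩
  · rintro ⟨h₁, h₂⟩
    by_cases hc : c.Holds s
    · obtain ⟨t, s', he, h⟩ := h₁ hc
      exact ⟨_, _, .iteTrue hc he, h⟩
    · obtain ⟨t, s', he, h⟩ := h₂ hc
      exact ⟨_, _, .iteFalse hc he, h⟩

end rules

@[simp] theorem State.setReg_reg (s : State) (d x r : ℕ) :
    (s.setReg d x).reg r = if r = d then x else s.reg r := by
  simp [State.setReg, Function.update_apply]

@[simp] theorem State.setReg_bank (s : State) (d x : ℕ) : (s.setReg d x).bank = s.bank := rfl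

@[simp] theorem State.setCell_reg (s : State) (b a x : ℕ) : (s.setCell b a x).reg = s.reg := rfl

@[simp] theorem State.setCell_bank (s : State) (b a x b' : ℕ) :
    (s.setCell b a x).bank b' = if b' = b then Function.update (s.bank b) a x else s.bank b' := by
  simp [State.setCell, Function.update_apply]

/-- Sequential composition of a list of programs. -/
def block : List Prog → Prog
  | [] => .skip
  | P :: l => .seq P (block l)

@[simp] theorem wp_block_nil {W : ℕ} {s : State} {Q : ℕ → State → Prop} :
    WP W (block []) s Q ↔ Q 1 s := wp_skip

@[simp] theorem wp_block_cons {W : ℕ} {s : State} {Q : ℕ → State → Prop} {P : Prog}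
    {l : List Prog} :
    WP W (block (P :: l)) s Q ↔ WP W P s (fun t s' => WP W (block l) s' (fun t' => Q (t + t'))) :=
  wp_seq

/-! ### Frames -/

/-- The registers that a program can write. -/
def Prog.wregs : Prog → List ℕ
  | .skip => []
  | .const d _ => [d]
  | .op _ d _ _ => [d]
  | .load d _ _ => [d]
  | .store _ _ _ => []
  | .seq P Q => P.wregs ++ Q.wregs
  | .ite _ P Q => P.wregs ++ Q.wregs
  | .while _ P => P.wregs

/-- The banks that a program can write. -/
def Prog.wbanks : Prog → List ℕ
  | .skip => []
  | .const _ _ => []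
  | .op _ _ _ _ => []
  | .load _ _ _ => []
  | .store b _ _ => [b]
  | .seq P Q => P.wbanks ++ Q.wbanks
  | .ite _ P Q => P.wbanks ++ Q.wbanks
  | .while _ P => P.wbanks

/-- The states agree outside the given registers and banks. -/
structure Agree (rs bs : List ℕ) (s s' : State) : Prop where
  reg : ∀ r, r ∉ rs → s'.reg r = s.reg r
  bank : ∀ b, b ∉ bs → s'.bank b = s.bank b

theorem Agree.refl (rs bs : List ℕ) (s : State) : Agree rs bs s s :=
  ⟨fun _ _ => rfl, fun _ _ => rfl⟩

theorem Agree.trans {rs bs : List ℕ} {s s' s'' : State} (h : Agree rs bs s s')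
    (h' : Agree rs bs s' s'') : Agree rs bs s s'' :=
  ⟨fun r hr => (h'.reg r hr).trans (h.reg r hr), fun b hb => (h'.bank b hb).trans (h.bank b hb)⟩

theorem Agree.mono {rs bs rs' bs' : List ℕ} {s s' : State} (h : Agree rs bs s s')
    (hr : rs ⊆ rs') (hb : bs ⊆ bs') : Agree rs' bs' s s' :=
  ⟨fun r h' => h.reg r fun h'' => h' (hr h''), fun b h' => h.bank b fun h'' => h' (hb h'')⟩

/-- What a program may overwrite is read off its syntax, so the frame conditions of the concrete
loops are settled by `decide`. -/
theorem Exec.agree {W : ℕ} {P : Prog} {s s' : State} {t : ℕ} (h : Exec W P s t s') :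
    Agree P.wregs P.wbanks s s' := by
  induction h with
  | skip s => exact Agree.refl _ _ s
  | const s d c h =>
    exact ⟨fun r hr => by simp_all [Prog.wregs], fun b _ => rfl⟩
  | op s o d a b h =>
    exact ⟨fun r hr => by simp_all [Prog.wregs], fun b _ => rfl⟩
  | load s d b a h =>
    exact ⟨fun r hr => by simp_all [Prog.wregs], fun b _ => rfl⟩
  | store s b a d h =>
    exact ⟨fun r _ => rfl, fun b hb => by simp_all [Prog.wbanks]⟩
  | seq _ _ h₁ h₂ =>
    exact (h₁.mono (by simp [Prog.wregs]) (by simp [Prog.wbanks])).trans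
      (h₂.mono (by simp [Prog.wregs]) (by simp [Prog.wbanks]))
  | iteTrue _ _ h => exact h.mono (by simp [Prog.wregs]) (by simp [Prog.wbanks])
  | iteFalse _ _ h => exact h.mono (by simp [Prog.wregs]) (by simp [Prog.wbanks])
  | whileFalse _ => exact Agree.refl _ _ _
  | whileTrue _ _ _ h₁ h₂ => exact Agree.trans h₁ h₂

theorem WP.frame {W : ℕ} {P : Prog} {s : State} {Q : ℕ → State → Prop} (h : WP W P s Q) :
    WP W P s (fun t s' => Q t s' ∧ Agree P.wregs P.wbanks s s') :=
  let ⟨t, s', he, hq⟩ := h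
  ⟨t, s', he, hq, he.agree⟩

/-! ### Counting loops -/

/-- `for reg r := 0, …, reg lim - 1 do body`; register `4` has to hold the number one. -/
def forLoop (r lim : ℕ) (body : Prog) : Prog :=
  .seq (.const r 0) (.while (.lt r lim) (.seq body (.op .add r r 4)))

/-- Induction on the number `d` of rounds left. The invariant has to survive writes to the counter,
which is incremented after the body; all else that a round needs comes from agreement with `s₀`. -/
theorem wp_while_aux {W r lim L τ : ℕ} {body : Prog} {s₀ : State} (I : ℕ → State → Prop)
    (hL : s₀.reg lim = L) (h1 : s₀.reg 4 = 1) (hLW : L < W)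
    (hr : r ∉ body.wregs) (hlim : lim ∉ r :: body.wregs) (h4 : 4 ∉ r :: body.wregs)
    (hI : ∀ i s x, I i s → I i (s.setReg r x))
    (hbody : ∀ i s, i < L → s.reg r = i → Agree (r :: body.wregs) body.wbanks s₀ s → I i s →
      WP W body s (fun t s' => t ≤ τ ∧ I (i + 1) s')) :
    ∀ d i s, i + d = L → s.reg r = i → Agree (r :: body.wregs) body.wbanks s₀ s → I i s →
      WP W (.while (.lt r lim) (.seq body (.op .add r r 4))) s
        (fun t s' => t ≤ (τ + 2) * d + 1 ∧ I L s' ∧ Agree (r :: body.wregs) body.wbanks s₀ s') := by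
  intro d
  induction d with
  | zero =>
    intro i s hi hs ha hIi
    refine ⟨1, s, .whileFalse ?_, by simp, ?_, ha⟩
    · have := ha.reg lim hlim
      simp only [Test.Holds]
      omega
    · simpa [← hi] using hIi
  | succ d ih =>
    intro i s hi hs ha hIi
    obtain ⟨t, s', he, ⟨ht, hI'⟩, ha'⟩ := (hbody i s (by omega) hs ha hIi).frame
    have hr' : s'.reg r = i := (ha'.reg r hr).trans hs
    have ha'' : Agree (r :: body.wregs) body.wbanks s₀ s' :=
      ha.trans (ha'.mono (List.subset_cons_self _ _) (List.Subset.refl _))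
    have h4' : s'.reg 4 = 1 := (ha''.reg 4 h4).trans h1
    have hop := Exec.op (W := W) s' .add r r 4 (by simp only [Op.eval]; omega)
    have hv : Op.add.eval (s'.reg r) (s'.reg 4) = i + 1 := by simp [Op.eval, hr', h4']
    rw [hv] at hop
    obtain ⟨t₂, s₂, he₂, ht₂, hI₂, ha₂⟩ := ih (i + 1) (s'.setReg r (i + 1)) (by omega) (by simp)
      (ha''.trans ⟨fun x hx => by simp_all, fun _ _ => rfl⟩) (hI _ _ _ hI')
    refine ⟨_, _, .whileTrue ?_ (.seq he hop) he₂, ?_, hI₂, ha₂⟩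
    · have := ha.reg lim hlim
      simp only [Test.Holds]
      omega
    · rw [Nat.mul_add]
      omega

/-- The time bound is stated with `M ≥ 1` in place of `L`, so that it also covers the initial steps
of an empty loop. -/
theorem wp_forLoop {W r lim L M τ : ℕ} {body : Prog} {s₀ : State} (I : ℕ → State → Prop)
    (hL : s₀.reg lim = L) (h1 : s₀.reg 4 = 1) (hLW : L < W) (hLM : L ≤ M) (hM : 1 ≤ M)
    (hr : r ∉ body.wregs) (hlim : lim ∉ r :: body.wregs) (h4 : 4 ∉ r :: body.wregs)
    (hI : ∀ i s x, I i s → I i (s.setReg r x)) (h0 : I 0 s₀)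
    (hbody : ∀ i s, i < L → s.reg r = i → Agree (r :: body.wregs) body.wbanks s₀ s → I i s →
      WP W body s (fun t s' => t ≤ τ ∧ I (i + 1) s')) :
    WP W (forLoop r lim body) s₀ (fun t s' => t ≤ (τ + 4) * M ∧ I L s' ∧
      Agree (r :: body.wregs) body.wbanks s₀ s') := by
  unfold forLoop
  rw [wp_seq, wp_const]
  refine ⟨by omega, ?_⟩
  refine (wp_while_aux I hL h1 hLW hr hlim h4 hI hbody L 0 (s₀.setReg r 0) (by omega) (by simp)
    ⟨fun x hx => ?_, fun _ _ => rfl⟩ (hI _ _ _ h0)).mono ?_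
  · rw [State.setReg_reg, if_neg fun h => hx (by simp [h])]
  rintro t s' ⟨ht, h⟩
  refine ⟨?_, h⟩
  have := Nat.mul_le_mul_left (τ + 2) hLM
  nlinarith

/-! ## The input clustering with the smallest total distance

Registers `0`, `1`, `2` hold `n`, `m`, `k`, register `4` holds one and register `5` holds zero. -/

/-- Whether the points `u`, `v` are together in exactly one of the clusterings `i`, `j`. -/
def pairCost (L : ℕ → ℕ) (n i j u v : ℕ) : ℕ :=
  if (L (i * n + u) = L (i * n + v) ↔ L (j * n + u) = L (j * n + v)) then 0 else 1

theorem pairCost_le_one (L : ℕ → ℕ) (n i j u v : ℕ) : pairCost L n i j u v ≤ 1 := by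
  unfold pairCost
  split_ifs <;> omega

/-- Twice the distance of the clusterings `i`, `j`. -/
def labelDist (L : ℕ → ℕ) (n i j : ℕ) : ℕ :=
  ∑ u ∈ range n, ∑ v ∈ range n, pairCost L n i j u v

/-- Twice the total distance of the clustering `i` to all of them. -/
def totalDist (L : ℕ → ℕ) (n m i : ℕ) : ℕ := ∑ j ∈ range m, labelDist L n i j

theorem sum_range_le_mul {f : ℕ → ℕ} {b x i : ℕ} (hi : i ≤ x) (h : ∀ j, f j ≤ b) :
    ∑ j ∈ range i, f j ≤ x * b := by
  calc ∑ j ∈ range i, f j ≤ i * b := by simpa using Finset.sum_le_card_nsmul (range i) f b (by simp [h])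
    _ ≤ _ := Nat.mul_le_mul_right _ hi

theorem sum_pairCost_le (L : ℕ → ℕ) (n i j u : ℕ) {x : ℕ} (hx : x ≤ n) :
    ∑ v ∈ range x, pairCost L n i j u v ≤ n := by
  simpa using sum_range_le_mul hx (pairCost_le_one L n i j u)

theorem sum_sum_pairCost_le (L : ℕ → ℕ) (n i j : ℕ) {x : ℕ} (hx : x ≤ n) :
    ∑ u ∈ range x, ∑ v ∈ range n, pairCost L n i j u v ≤ n * n :=
  sum_range_le_mul hx fun u => sum_pairCost_le L n i j u le_rfl

theorem sum_labelDist_le (L : ℕ → ℕ) (n m i : ℕ) {x : ℕ} (hx : x ≤ m) :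
    ∑ j ∈ range x, labelDist L n i j ≤ m * (n * n) :=
  sum_range_le_mul hx fun j => sum_sum_pairCost_le L n i j le_rfl

theorem mul_add_lt_mul {i m n u : ℕ} (hi : i < m) (hu : u < n) : i * n + u < m * n := by
  have := Nat.mul_le_mul_right n (Nat.succ_le_of_lt hi)
  rw [Nat.succ_mul] at this
  omega

def pairStep : Prog := block [
  .op .mul 14 10 0, .op .add 15 14 12, .load 15 1 15, .op .add 16 14 13, .load 16 1 16,
  .op .mul 14 11 0, .op .add 17 14 12, .load 17 1 17, .op .add 18 14 13, .load 18 1 18,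
  .ite (.eq 15 16) (.ite (.eq 17 18) .skip (.op .add 20 20 4))
    (.ite (.eq 17 18) (.op .add 20 20 4) .skip)]

section median

variable {W n m : ℕ} {L : ℕ → ℕ}

theorem pairStep_wp {s : State} {i j u v : ℕ} (hn : s.reg 0 = n) (h1 : s.reg 4 = 1)
    (hi : s.reg 10 = i) (hj : s.reg 11 = j) (hu : s.reg 12 = u) (hv : s.reg 13 = v)
    (hL : s.bank 1 = L) (him : i < m) (hjm : j < m) (hun : u < n) (hvn : v < n)
    (hLW : ∀ a < m * n, L a < W) (hW : m * n ≤ W) (hacc : s.reg 20 + 1 < W) :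
    WP W pairStep s (fun t s' => t ≤ 20 ∧ s'.reg 20 = s.reg 20 + pairCost L n i j u v) := by
  have a1 := mul_add_lt_mul him hun
  have a2 := mul_add_lt_mul him hvn
  have a3 := mul_add_lt_mul hjm hun
  have a4 := mul_add_lt_mul hjm hvn
  have b1 := hLW _ a1
  have b2 := hLW _ a2
  have b3 := hLW _ a3
  have b4 := hLW _ a4
  have c1 : i * n < W := by omega
  have c2 : j * n < W := by omega
  simp [pairStep, Op.eval, Test.Holds, hn, h1, hi, hj, hu, hv, hL, b1, b2, b3, b4, c1, c2,
    a1.trans_le hW, a2.trans_le hW, a3.trans_le hW, a4.trans_le hW, hacc, pairCost]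
  tauto

theorem rowLoop_wp {s : State} {i j u : ℕ} (hn : s.reg 0 = n) (h1 : s.reg 4 = 1)
    (hi : s.reg 10 = i) (hj : s.reg 11 = j) (hu : s.reg 12 = u)
    (hL : s.bank 1 = L) (him : i < m) (hjm : j < m) (hun : u < n)
    (hLW : ∀ a < m * n, L a < W) (hW : m * n ≤ W) (hnW : n < W) (hacc : s.reg 20 + n < W) :
    WP W (forLoop 13 0 pairStep) s (fun t s' => t ≤ 24 * n ∧
      s'.reg 20 = s.reg 20 + ∑ v ∈ range n, pairCost L n i j u v) := by
  refine (wp_forLoop (τ := 20) (M := n)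
    (fun x s' => s'.reg 20 = s.reg 20 + ∑ v ∈ range x, pairCost L n i j u v) hn h1 hnW le_rfl
    (by omega) (by decide) (by decide) (by decide) (by simp) (by simp) ?_).mono
    (fun t s' h => ⟨h.1, h.2.1⟩)
  intro v s' hv hr ha hI
  have := sum_pairCost_le L n i j u hv.le
  have := (pairStep_wp (m := m) (L := L) (W := W) ((ha.reg 0 (by decide)).trans hn)
    ((ha.reg 4 (by decide)).trans h1) ((ha.reg 10 (by decide)).trans hi)
    ((ha.reg 11 (by decide)).trans hj) ((ha.reg 12 (by decide)).trans hu) hr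
    ((ha.bank 1 (by decide)).trans hL) him hjm hun hv hLW hW (by
      have := sum_range_le_mul (b := 1) (x := v) le_rfl (pairCost_le_one L n i j u)
      omega))
  refine this.mono fun t s'' h => ⟨h.1, ?_⟩
  rw [h.2, hI, Finset.sum_range_succ, add_assoc]

theorem squareLoop_wp {s : State} {i j : ℕ} (hn : s.reg 0 = n) (h1 : s.reg 4 = 1)
    (hi : s.reg 10 = i) (hj : s.reg 11 = j)
    (hL : s.bank 1 = L) (him : i < m) (hjm : j < m) (hn1 : 1 ≤ n)
    (hLW : ∀ a < m * n, L a < W) (hW : m * n ≤ W) (hnW : n < W) (hacc : s.reg 20 + n * n < W) :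
    WP W (forLoop 12 0 (forLoop 13 0 pairStep)) s (fun t s' => t ≤ (24 * n + 4) * n ∧
      s'.reg 20 = s.reg 20 + labelDist L n i j) := by
  refine (wp_forLoop (τ := 24 * n) (M := n)
    (fun x s' => s'.reg 20 = s.reg 20 + ∑ u ∈ range x, ∑ v ∈ range n, pairCost L n i j u v)
    hn h1 hnW le_rfl
    hn1 (by decide) (by decide) (by decide) (by simp) (by simp) ?_).mono
    (fun t s' h => ⟨h.1, h.2.1⟩)
  intro u s' hu hr ha hI
  have hb := sum_range_le_mul (x := u) le_rfl fun u => sum_pairCost_le L n i j u (le_refl n)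
  have hu' : u * n + n ≤ n * n := by
    have := Nat.mul_le_mul_right n (Nat.succ_le_of_lt hu)
    rwa [Nat.succ_mul] at this
  have := (rowLoop_wp (m := m) (L := L) (W := W) ((ha.reg 0 (by decide)).trans hn)
    ((ha.reg 4 (by decide)).trans h1) ((ha.reg 10 (by decide)).trans hi)
    ((ha.reg 11 (by decide)).trans hj) hr
    ((ha.bank 1 (by decide)).trans hL) him hjm hu hLW hW hnW (by omega))
  refine this.mono fun t s'' h => ⟨h.1, ?_⟩
  rw [h.2, hI, Finset.sum_range_succ, add_assoc]

theorem totalLoop_wp {s : State} {i : ℕ} (hn : s.reg 0 = n) (hm : s.reg 1 = m) (h1 : s.reg 4 = 1)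
    (hi : s.reg 10 = i)
    (hL : s.bank 1 = L) (him : i < m) (hn1 : 1 ≤ n)
    (hLW : ∀ a < m * n, L a < W) (hW : m * (n * n) < W) (hacc : s.reg 20 = 0) :
    WP W (forLoop 11 1 (forLoop 12 0 (forLoop 13 0 pairStep))) s
      (fun t s' => t ≤ ((24 * n + 4) * n + 4) * m ∧ s'.reg 20 = totalDist L n m i) := by
  have hmn : m * n ≤ m * (n * n) := Nat.mul_le_mul_left _ (Nat.le_mul_of_pos_left _ hn1)
  have hnm : n ≤ m * n := Nat.le_mul_of_pos_left _ (by omega)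
  have hmm : m ≤ m * n := Nat.le_mul_of_pos_right _ (by omega)
  refine (wp_forLoop (τ := (24 * n + 4) * n) (M := m)
    (fun x s' => s'.reg 20 = ∑ j ∈ range x, labelDist L n i j)
    hm h1 (by omega) le_rfl
    (by omega) (by decide) (by decide) (by decide) (by simp) (by simpa using hacc) ?_).mono
    (fun t s' h => ⟨h.1, h.2.1⟩)
  intro j s' hj hr ha hI
  have hb := sum_range_le_mul (x := j) le_rfl fun j => sum_sum_pairCost_le L n i j (le_refl n)
  have hj' : j * (n * n) + n * n ≤ m * (n * n) := by
    have := Nat.mul_le_mul_right (n * n) (Nat.succ_le_of_lt hj)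
    rwa [Nat.succ_mul] at this
  have := (squareLoop_wp (m := m) (L := L) (W := W) ((ha.reg 0 (by decide)).trans hn)
    ((ha.reg 4 (by decide)).trans h1) ((ha.reg 10 (by decide)).trans hi) hr
    ((ha.bank 1 (by decide)).trans hL) him hj hn1 hLW (by omega) (by omega) (by
      rw [hI]
      unfold labelDist
      omega))
  refine this.mono fun t s'' h => ⟨h.1, ?_⟩
  rw [h.2, hI, Finset.sum_range_succ]

def medianStep : Prog := block [
  .const 20 0, forLoop 11 1 (forLoop 12 0 (forLoop 13 0 pairStep)),
  .ite (.lt 20 21) (block [.op .add 21 20 5, .op .add 22 10 5]) .skip]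

/-- Register `22` receives the index of an input clustering with the smallest total distance. -/
def median : Prog := block [
  -- Register `21` starts at $mn^2+1$, above every total distance, so the first clustering is always
  -- accepted.
  .op .mul 21 0 0, .op .mul 21 1 21, .op .add 21 21 4, forLoop 10 1 medianStep]

/-- The best of the first `i` clusterings has index `b` and total distance `d`. -/
def IsBest (L : ℕ → ℕ) (n m i d b : ℕ) : Prop :=
  (i = 0 ∧ d = m * (n * n) + 1) ∨
    (b < i ∧ d = totalDist L n m b ∧ ∀ i' < i, totalDist L n m b ≤ totalDist L n m i')

theorem medianStep_wp {s : State} {i : ℕ} (hn : s.reg 0 = n) (hm : s.reg 1 = m)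
    (h1 : s.reg 4 = 1) (h0 : s.reg 5 = 0) (hi : s.reg 10 = i)
    (hL : s.bank 1 = L) (him : i < m) (hn1 : 1 ≤ n)
    (hLW : ∀ a < m * n, L a < W) (hW : m * (n * n) < W)
    (hI : IsBest L n m i (s.reg 21) (s.reg 22)) :
    WP W medianStep s (fun t s' => t ≤ ((24 * n + 4) * n + 4) * m + 20 ∧
      IsBest L n m (i + 1) (s'.reg 21) (s'.reg 22)) := by
  have hmn : m * n ≤ m * (n * n) := Nat.mul_le_mul_left _ (Nat.le_mul_of_pos_left _ hn1)
  have hmm : m ≤ m * n := Nat.le_mul_of_pos_right _ (by omega)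
  unfold medianStep
  rw [wp_block_cons, wp_const]
  refine ⟨by omega, ?_⟩
  rw [wp_block_cons]
  refine (totalLoop_wp (m := m) (L := L) (W := W) (s := s.setReg 20 0) (by simpa) (by simpa)
    (by simpa) (by simpa) (by simpa) him hn1 hLW hW (by simp)).frame.mono ?_
  rintro t s' ⟨⟨ht, hs⟩, ha⟩
  have g1 : s'.reg 21 = s.reg 21 := (ha.reg 21 (by decide)).trans (by simp)
  have g2 : s'.reg 22 = s.reg 22 := (ha.reg 22 (by decide)).trans (by simp)
  have g3 : s'.reg 5 = 0 := (ha.reg 5 (by decide)).trans (by simpa)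
  have g4 : s'.reg 10 = i := (ha.reg 10 (by decide)).trans (by simpa)
  have hle := sum_labelDist_le L n m i (le_refl m)
  have hle' : totalDist L n m i < W := lt_of_le_of_lt hle hW
  have hiW : i < W := by omega
  simp only [wp_block_cons, wp_ite, Test.Holds, wp_op, Op.eval, State.setReg_reg, g1, g2, g3, g4,
    hs, wp_skip, wp_block_nil, if_true, add_zero, hle', hiW, true_and, if_false,
    Nat.reduceEqDiff]
  refine ⟨fun hlt => ⟨by omega, ?_⟩, fun hge => ⟨by omega, ?_⟩⟩
  · refine Or.inr ⟨by omega, rfl, fun i' hi' => ?_⟩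
    rcases Nat.lt_succ_iff_lt_or_eq.1 hi' with h | rfl
    · rcases hI with ⟨h', _⟩ | ⟨_, hd, hb⟩
      · omega
      · have := hb i' h
        omega
    · exact le_rfl
  · rcases hI with ⟨h', hd⟩ | ⟨hlt, hd, hb⟩
    · rw [hd] at hge
      unfold totalDist at hge
      omega
    · refine Or.inr ⟨by omega, hd, fun i' hi' => ?_⟩
      rcases Nat.lt_succ_iff_lt_or_eq.1 hi' with h | rfl
      · exact hb i' h
      · omega

theorem median_wp {s : State} (hn : s.reg 0 = n) (hm : s.reg 1 = m)
    (h1 : s.reg 4 = 1) (h0 : s.reg 5 = 0)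
    (hL : s.bank 1 = L) (hm1 : 1 ≤ m) (hn1 : 1 ≤ n)
    (hLW : ∀ a < m * n, L a < W) (hW : m * (n * n) + 1 < W) :
    WP W median s (fun t s' => t ≤ 60 * (m ^ 2 * n ^ 2) ∧
      s'.reg 22 < m ∧ ∀ i < m, totalDist L n m (s'.reg 22) ≤ totalDist L n m i) := by
  have hmn : m * n ≤ m * (n * n) := Nat.mul_le_mul_left _ (Nat.le_mul_of_pos_left _ hn1)
  have hmm : m ≤ m * n := Nat.le_mul_of_pos_right _ (by omega)
  have hnn : n * n ≤ m * (n * n) := Nat.le_mul_of_pos_left _ (by omega)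
  unfold median
  simp only [wp_block_cons, wp_op, Op.eval, State.setReg_reg, hn, hm, h1, if_true, if_false,
    Nat.reduceEqDiff, wp_block_nil, OfNat.one_ne_ofNat]
  refine ⟨by omega, by omega, by omega, ?_⟩
  refine (wp_forLoop (L := m) (M := m) (τ := ((24 * n + 4) * n + 4) * m + 20)
    (fun i s' => IsBest L n m i (s'.reg 21) (s'.reg 22)) ?_ ?_ (by omega) le_rfl hm1 (by decide)
    (by decide) (by decide) (by simp) ?_ ?_).mono ?_
  · simpa
  · simpa
  · exact Or.inl ⟨rfl, by simp⟩
  · intro i s' hi hr ha hI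
    exact medianStep_wp ((ha.reg 0 (by decide)).trans (by simpa))
      ((ha.reg 1 (by decide)).trans (by simpa)) ((ha.reg 4 (by decide)).trans (by simpa))
      ((ha.reg 5 (by decide)).trans (by simpa)) hr
      ((ha.bank 1 (by decide)).trans (by simpa)) hi hn1 hLW (by omega) hI
  · rintro t s' ⟨ht, hI, -⟩
    refine ⟨?_, ?_⟩
    · have k1 : m ^ 2 * n ≤ m ^ 2 * n ^ 2 := Nat.mul_le_mul_left _ (Nat.le_self_pow two_ne_zero n)
      have k2 : m ^ 2 ≤ m ^ 2 * n := Nat.le_mul_of_pos_right _ hn1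
      have k3 : m ≤ m ^ 2 := Nat.le_self_pow two_ne_zero m
      nlinarith only [ht, k1, k2, k3, hm1]
    · rcases hI with ⟨h, _⟩ | ⟨h, _, h'⟩
      · omega
      · exact ⟨h, h'⟩

end median

/-! ## Rounding a cluster to a multiple of the color proportions -/

section rounding

variable {κ : Type*} [Fintype κ]

/-- The distance of the color counts `x` from `t` times the proportions `p`. -/
def imbalance (x p : κ → ℕ) (t : ℕ) : ℤ := ∑ c, |(x c : ℤ) - t * p c|

theorem abs_sum_sub_le_imbalance (x p : κ → ℕ) (t : ℕ) :
    |((∑ c, x c : ℕ) : ℤ) - t * (∑ c, p c : ℕ)| ≤ imbalance x p t := by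
  have : ((∑ c, x c : ℕ) : ℤ) - t * (∑ c, p c : ℕ) = ∑ c, ((x c : ℤ) - t * p c) := by
    push_cast
    rw [Finset.mul_sum, Finset.sum_sub_distrib]
  rw [this]
  exact Finset.abs_sum_le_sum_abs _ _

theorem imbalance_le_add (x p : κ → ℕ) (t t' : ℕ) :
    imbalance x p t' ≤ imbalance x p t + |((t * ∑ c, p c : ℕ) : ℤ) - (t' * ∑ c, p c : ℕ)| := by
  have h : |((t * ∑ c, p c : ℕ) : ℤ) - (t' * ∑ c, p c : ℕ)| = ∑ c, |(t : ℤ) - t'| * p c := by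
    push_cast
    rw [← sub_mul, abs_mul, ← Finset.mul_sum]
    congr 1
    exact abs_of_nonneg (by positivity)
  rw [h, imbalance, imbalance, ← Finset.sum_add_distrib]
  refine Finset.sum_le_sum fun c _ => ?_
  have : |(t : ℤ) - t'| * p c = |(t : ℤ) * p c - t' * p c| := by
    rw [← sub_mul, abs_mul, abs_of_nonneg (by positivity : (0 : ℤ) ≤ p c)]
  rw [this]
  calc |(x c : ℤ) - t' * p c| = |((x c : ℤ) - t * p c) + (t * p c - t' * p c)| := by ring_nf
    _ ≤ _ := abs_add_le _ _

/-- No multiple of `P` lies strictly between the two consecutive multiples around `s`. With this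
fact the rounding estimates become linear arithmetic. -/
theorem mul_le_or_le_mul {s P : ℕ} (t : ℕ) :
    t * P ≤ s / P * P ∨ (s / P + 1) * P ≤ t * P := by
  rcases Nat.lt_or_ge (s / P) t with h | h
  · exact .inr (Nat.mul_le_mul_right _ h)
  · exact .inl (Nat.mul_le_mul_right _ h)

/-- The imbalance is at least $|s - tP|$. When the remainder is at least $P/2$, the nearest multiple
of $P$ can be taken to be the one above $s$, at distance $P - (s \bmod P)$. -/
theorem sub_mod_le_imbalance {x p : κ → ℕ} {s P t : ℕ} (hs : s = ∑ c, x c) (hP : P = ∑ c, p c)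
    (hr : P ≤ 2 * (s % P)) : (P : ℤ) - (s % P : ℕ) ≤ imbalance x p t := by
  have h := abs_sum_sub_le_imbalance x p t
  rw [← hs, ← hP, ← Nat.cast_mul, abs_le] at h
  have h1 := Nat.div_add_mod' s P
  have h2 := mul_le_or_le_mul (s := s) (P := P) t
  rw [Nat.add_mul, one_mul] at h2
  generalize t * P = y at *
  generalize s / P * P = z at *
  generalize imbalance x p t = E at *
  omega

/-- Pays for a newly opened cluster of size $P$ when the moved point comes from a small cluster: $tP
\ge P > 2s$ forces $|s - tP| > P/2$. -/
theorem le_two_mul_imbalance {x p : κ → ℕ} {s P t : ℕ} (hs : s = ∑ c, x c) (hP : P = ∑ c, p c)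
    (ht : 1 ≤ t) (hr : 2 * s < P) : (P : ℤ) ≤ 2 * imbalance x p t := by
  have h := abs_sum_sub_le_imbalance x p t
  rw [← hs, ← hP, ← Nat.cast_mul, abs_le] at h
  have h1 : P ≤ t * P := Nat.le_mul_of_pos_left _ ht
  generalize t * P = y at *
  generalize imbalance x p t = E at *
  omega

/-- Passing from $t$ to $T$ units costs $|t - T|P$. If $TP$ is a multiple nearest to $s$, this is at
most $2|s - tP|$. A candidate rounded down still satisfies $|t - T|P \le |s - tP| + P$. -/
theorem imbalance_round_le {x p : κ → ℕ} {s P T : ℕ} (t : ℕ) (hs : s = ∑ c, x c)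
    (hP : P = ∑ c, p c) (hP0 : 0 < P)
    (hT : T = s / P ∨ (T = s / P + 1 ∧ P ≤ 2 * (s % P))) :
    imbalance x p T ≤
      3 * imbalance x p t + if P ≤ 2 * (s % P) ∧ T = s / P then (P : ℤ) else 0 := by
  have h := abs_sum_sub_le_imbalance x p t
  rw [← hs, ← hP, ← Nat.cast_mul, abs_le] at h
  have h1 := Nat.div_add_mod' s P
  have h2 := mul_le_or_le_mul (s := s) (P := P) t
  have h3 := imbalance_le_add x p t T
  rw [← hP] at h3
  have hm := Nat.mod_lt s hP0
  rw [Nat.add_mul, one_mul] at h2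
  rcases hT with rfl | ⟨rfl, hr⟩
  · generalize t * P = y at *
    generalize s / P * P = z at *
    generalize imbalance x p t = E at *
    rcases abs_cases ((y : ℤ) - z) with ⟨e, _⟩ | ⟨e, _⟩ <;> rw [e] at h3 <;>
      split_ifs with hr <;> omega
  · rw [Nat.add_mul, one_mul] at h3
    rw [if_neg (by omega)]
    generalize t * P = y at *
    generalize s / P * P = z at *
    generalize imbalance x p t = E at *
    rcases abs_cases ((y : ℤ) - (z + P : ℕ)) with ⟨e, _⟩ | ⟨e, _⟩ <;> rw [e] at h3 <;> omega

end rounding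

/-- Leaving the smallest candidates not rounded up costs at most the total deficit. -/
theorem sum_mul_le_of_greedy {ι : Type*} (U B : Finset ι) (s δ : ι → ℕ) (P : ℕ) (hB : B ⊆ U)
    (hδ : ∀ a ∈ U, δ a ≤ P) (hs : ∀ a ∈ B, ∀ b ∈ U \ B, s a ≤ s b)
    (hc : B.Nonempty → #B * P ≤ ∑ a ∈ U, δ a) :
    ∑ a ∈ B, s a * P ≤ ∑ a ∈ U, s a * δ a := by
  rcases B.eq_empty_or_nonempty with rfl | hne
  · simp
  -- The largest size in `B` acts as a common price: it is at least every size in `B` and at most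
  -- every size in `U \ B`.
  obtain ⟨a₀, ha₀, hmax⟩ := B.exists_max_image s hne
  have hc := hc hne
  rw [← Finset.sum_sdiff hB] at hc ⊢
  have h1 : s a₀ * ∑ a ∈ U \ B, δ a ≤ ∑ a ∈ U \ B, s a * δ a := by
    rw [Finset.mul_sum]
    exact Finset.sum_le_sum fun b hb => Nat.mul_le_mul_right _ (hs _ ha₀ _ hb)
  have h2 : ∑ a ∈ B, s a * P ≤ ∑ a ∈ B, (s a * δ a + s a₀ * (P - δ a)) := by
    refine Finset.sum_le_sum fun a ha => ?_
    obtain ⟨d, hd⟩ := Nat.exists_eq_add_of_le (hδ a (hB ha))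
    rw [hd, Nat.add_sub_cancel_left, Nat.mul_add]
    exact Nat.add_le_add_left (Nat.mul_le_mul_right _ (hmax a ha)) _
  have h3 : ∑ a ∈ B, (P - δ a) + ∑ a ∈ B, δ a = #B * P := by
    rw [← Finset.sum_add_distrib, Finset.sum_congr rfl fun a ha => Nat.sub_add_cancel (hδ a (hB ha))]
    simp
  rw [Finset.sum_add_distrib, ← Finset.mul_sum] at h2
  -- By `h3`, the count hypothesis says that the shortfall of `B` is covered by the deficits outside
  -- `B`.
  have h4 : s a₀ * ∑ a ∈ B, (P - δ a) ≤ s a₀ * ∑ a ∈ U \ B, δ a :=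
    Nat.mul_le_mul_left _ (by omega)
  omega

/-! ## Labelings and their distance -/

section labelings

variable {n : ℕ}

/-- The points that are together with `u` in exactly one of the two labelings. -/
def disagree (f g : Fin n → ℕ) (u : Fin n) : Finset (Fin n) :=
  {v | ¬ (f u = f v ↔ g u = g v)}

theorem sum_card_filter_comm {ι κ : Type*} (A : Finset ι) (B : Finset κ) (r : ι → κ → Prop)
    [∀ a b, Decidable (r a b)] :
    ∑ a ∈ A, #{b ∈ B | r a b} = ∑ b ∈ B, #{a ∈ A | r a b} := by
  simp_rw [Finset.card_filter]
  exact Finset.sum_comm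

/-- If every point outside `M` keeps its label, the disagreements all involve `M`. -/
theorem sum_disagree_le_of_kept {f g : Fin n → ℕ} (M : Finset (Fin n))
    (h : ∀ u, u ∉ M → g u = f u) :
    ∑ u, #(disagree f g u) ≤ 2 * ∑ u ∈ M, #(disagree f g u) := by
  -- Two points outside `M` never disagree, so a disagreement at `u ∉ M` has its other endpoint in
  -- `M`; by symmetry it is counted there a second time.
  have h1 : ∀ u, #(disagree f g u) ≤
      (if u ∈ M then #(disagree f g u) else 0) + #{v ∈ M | v ∈ disagree f g u} := by
    intro u
    split_ifs with hu
    · omega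
    · rw [zero_add]
      refine Finset.card_le_card fun v hv => ?_
      rw [mem_filter]
      refine ⟨by_contra fun hvM => ?_, hv⟩
      simp [disagree, h u hu, h v hvM] at hv
  have h2 : ∑ u, #{v ∈ M | v ∈ disagree f g u} = ∑ u ∈ M, #(disagree f g u) := by
    rw [sum_card_filter_comm]
    refine Finset.sum_congr rfl fun u _ => congrArg _ ?_
    ext v
    simp [disagree, eq_comm]
  calc _ ≤ ∑ u, ((if u ∈ M then #(disagree f g u) else 0) + #{v ∈ M | v ∈ disagree f g u}) :=
        Finset.sum_le_sum fun u _ => h1 u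
    _ = _ := by
        rw [Finset.sum_add_distrib, h2, Finset.sum_ite_mem, Finset.univ_inter, two_mul]

theorem card_disagree_le {f g : Fin n → ℕ} (u : Fin n) :
    #(disagree f g u) ≤ #{v | f v = f u} + #{v | g v = g u} := by
  rw [← Finset.card_union_add_card_inter]
  refine le_trans (Finset.card_le_card fun v hv => ?_) (Nat.le_add_right _ _)
  simp only [disagree, mem_filter, mem_univ, true_and, mem_union] at hv ⊢
  by_contra hc
  push Not at hc
  exact hv ⟨fun h => absurd h.symm hc.1, fun h => absurd h.symm hc.2⟩

variable {k : ℕ}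

theorem card_eq_sum_color (color : Fin n → Fin k) (q : Fin n → Prop) [DecidablePred q] :
    #{v | q v} = ∑ c, #{v | q v ∧ color v = c} := by
  rw [Finset.card_eq_sum_card_fiberwise (f := color) (t := Finset.univ) (fun _ _ => by simp)]
  simp [Finset.filter_filter]

/-- The disagreements at `u` form the symmetric difference of its two clusters, which in each color
has at least as many points as the two counts differ. All lower bounds on the cost of a fair
labeling rest on this. -/
theorem imbalance_le_card_disagree (color : Fin n → Fin k) {f g : Fin n → ℕ}
    (u : Fin n) {p : Fin k → ℕ} {t : ℕ}
    (ht : ∀ c, #{v | g v = g u ∧ color v = c} = t * p c) :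
    imbalance (fun c => #{v | f v = f u ∧ color v = c}) p t ≤ #(disagree f g u) := by
  have h : #(disagree f g u) = ∑ c, #{v | v ∈ disagree f g u ∧ color v = c} := by
    rw [← card_eq_sum_color color]
    simp
  rw [h, imbalance, Nat.cast_sum]
  refine Finset.sum_le_sum fun c _ => ?_
  rw [← Nat.cast_mul, ← ht c]
  have h1 : #{v | f v = f u ∧ color v = c} ≤ #{v | g v = g u ∧ color v = c} +
      #{v | v ∈ disagree f g u ∧ color v = c} := by
    refine le_trans (Finset.card_le_card fun v hv => ?_) (Finset.card_union_le _ _)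
    simp only [disagree, mem_filter, mem_univ, true_and, mem_union] at hv ⊢
    have := hv.1.symm
    by_cases hg : g v = g u
    · exact .inl ⟨hg, hv.2⟩
    · exact .inr ⟨fun h => hg (h.1 this).symm, hv.2⟩
  have h2 : #{v | g v = g u ∧ color v = c} ≤ #{v | f v = f u ∧ color v = c} +
      #{v | v ∈ disagree f g u ∧ color v = c} := by
    refine le_trans (Finset.card_le_card fun v hv => ?_) (Finset.card_union_le _ _)
    simp only [disagree, mem_filter, mem_univ, true_and, mem_union] at hv ⊢
    have := hv.1.symm
    by_cases hg : f v = f u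
    · exact .inl ⟨hg, hv.2⟩
    · exact .inr ⟨fun h => hg (h.2 this).symm, hv.2⟩
  rw [abs_le]
  constructor <;> omega

end labelings

/-- The data of a greedy rounding of the labeling `f` to a fair labeling `out`.  There are `N`
units of size `P`, with `p c` points of color `c` each; label `j` receives `T j` units, and the
points in `keep` retain their label. -/
structure GreedyRounding {n k : ℕ} (color : Fin n → Fin k) (f : Fin n → ℕ) (N P : ℕ)
    (p : Fin k → ℕ) (T : ℕ → ℕ) (keep : Fin n → Prop) (out : Fin n → ℕ) : Prop where
  pos : 0 < P
  pos_units : 0 < N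
  mul_eq : N * P = n
  mul_color : ∀ c, N * p c = #{v | color v = c}
  label_lt : ∀ v, f v < n
  out_lt : ∀ v, out v < 2 * n
  out_eq : ∀ v, keep v → out v = f v
  card_keep : ∀ j < n, ∀ c, #{v | (keep v ∧ f v = j) ∧ color v = c} =
    min #{v | f v = j ∧ color v = c} (T j * p c)
  card_out : ∀ j < 2 * n, ∀ c, #{v | out v = j ∧ color v = c} = T j * p c
  units : ∀ j < n, T j = #{v | f v = j} / P ∨
    (T j = #{v | f v = j} / P + 1 ∧ P ≤ 2 * (#{v | f v = j} % P))
  units_new : ∀ j, n ≤ j → T j ≤ 1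
  sum_units : ∑ j ∈ range (2 * n), T j = N
  greedy : ∀ a < n, ∀ b < n, P ≤ 2 * (#{v | f v = a} % P) → T a = #{v | f v = a} / P →
    T b = #{v | f v = b} / P + 1 → #{v | f v = a} ≤ #{v | f v = b}
  greedy_new : ∀ a < n, P ≤ 2 * (#{v | f v = a} % P) → T a = #{v | f v = a} / P →
    ∀ j, n ≤ j → T j = 0

/-! ### Cost analysis of a greedy rounding -/

namespace GreedyRounding

variable {n k : ℕ} {color : Fin n → Fin k} {f : Fin n → ℕ} {N P : ℕ} {p : Fin k → ℕ}
  {T : ℕ → ℕ} {keep : Fin n → Prop} {out : Fin n → ℕ}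

theorem sum_eq (h : GreedyRounding color f N P p T keep out) : P = ∑ c, p c := by
  have h1 : N * P = N * ∑ c, p c := by
    rw [Finset.mul_sum, Finset.sum_congr rfl fun c _ => h.mul_color c, h.mul_eq]
    have := card_eq_sum_color color (fun _ => True)
    simpa using this
  exact Nat.eq_of_mul_eq_mul_left h.pos_units h1

theorem card_out_eq (h : GreedyRounding color f N P p T keep out) {j : ℕ} (hj : j < 2 * n) :
    #{v | out v = j} = T j * P := by
  rw [card_eq_sum_color color, Finset.sum_congr rfl fun c _ => h.card_out j hj c,
    ← Finset.mul_sum, h.sum_eq]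

/-- In color $c$, cluster `j` keeps $\min(x_c, T_j p_c)$ points. Those that leave are the surplus
and those that enter fill the shortage, together $|x_c - T_j p_c|$. -/
theorem card_moved (h : GreedyRounding color f N P p T keep out) {j : ℕ} (hj : j < n) :
    ((#{v | ¬ keep v ∧ f v = j} + #{v | ¬ keep v ∧ out v = j} : ℕ) : ℤ) =
      imbalance (fun c => #{v | f v = j ∧ color v = c}) p (T j) := by
  have h1 (q : Fin n → Prop) [DecidablePred q] (c : Fin k) : #{v | (¬ keep v ∧ q v) ∧ color v = c} +
      #{v | (keep v ∧ q v) ∧ color v = c} = #{v | q v ∧ color v = c} := by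
    rw [← Finset.card_union_of_disjoint]
    · congr 1
      ext v
      simp only [mem_union, mem_filter, mem_univ, true_and]
      tauto
    · rw [Finset.disjoint_left]
      intro v
      simp only [mem_filter, mem_univ, true_and]
      tauto
  rw [card_eq_sum_color color, card_eq_sum_color color, ← Finset.sum_add_distrib, imbalance,
    Nat.cast_sum]
  refine Finset.sum_congr rfl fun c _ => ?_
  have h2 := h1 (fun v => f v = j) c
  have h3 := h1 (fun v => out v = j) c
  have h4 : #{v | (keep v ∧ out v = j) ∧ color v = c} =
      #{v | (keep v ∧ f v = j) ∧ color v = c} := by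
    congr 1
    ext v
    simp only [mem_filter, mem_univ, true_and]
    refine and_congr_left fun _ => and_congr_right fun hk => ?_
    rw [h.out_eq v hk]
  rw [h4, h.card_keep j hj c, h.card_out j (by omega) c] at h3
  rw [h.card_keep j hj c] at h2
  rw [← Nat.cast_mul]
  generalize T j * p c = x at *
  rcases abs_cases ((#{v | f v = j ∧ color v = c} : ℤ) - x) with ⟨e, _⟩ | ⟨e, _⟩ <;> rw [e] <;> omega

/-- Rounding up requires a remainder of at least $P/2$, so it at most doubles the size. -/
theorem units_mul_le (h : GreedyRounding color f N P p T keep out) {j : ℕ} (hj : j < n) :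
    T j * P ≤ 2 * #{v | f v = j} := by
  have h1 := Nat.div_add_mod' #{v | f v = j} P
  rcases h.units j hj with hT | ⟨hT, hr⟩
  · rw [hT]
    omega
  · rw [hT, Nat.add_mul, one_mul]
    omega

/-- The clusters that deserve rounding up but are rounded down. -/
theorem sum_rounded_down_le (h : GreedyRounding color f N P p T keep out) :
    ∑ v, (if P ≤ 2 * (#{w | f w = f v} % P) ∧ T (f v) = #{w | f w = f v} / P then P else 0) ≤
      ∑ v, (if P ≤ 2 * (#{w | f w = f v} % P) then P - #{w | f w = f v} % P else 0) := by
  set s : ℕ → ℕ := fun j => #{w | f w = j} with hs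
  have hfib (x : ℕ → ℕ) : ∑ v, x (f v) = ∑ j ∈ range n, s j * x j := by
    rw [← Finset.sum_fiberwise_of_maps_to (g := f) (t := range n)
      fun v _ => mem_range.2 (h.label_lt v)]
    refine Finset.sum_congr rfl fun j _ => ?_
    rw [Finset.sum_congr rfl fun v hv => by rw [(mem_filter.1 hv).2], Finset.sum_const, smul_eq_mul]
  have e (q : ℕ → Prop) [DecidablePred q] (x : ℕ → ℕ) : ∑ v, (if q (f v) then x (f v) else 0) =
      ∑ j ∈ range n with q j, s j * x j := by
    rw [Finset.sum_filter, hfib fun j => if q j then x j else 0]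
    simp only [mul_ite, mul_zero]
  refine (e (fun j => P ≤ 2 * (s j % P) ∧ T j = s j / P) fun _ => P).le.trans (le_trans ?_
    (e (fun j => P ≤ 2 * (s j % P)) fun j => P - s j % P).ge)
  refine sum_mul_le_of_greedy _ _ s (fun j => P - s j % P) P ?_ ?_ ?_ ?_
  · intro j
    simp only [mem_filter]
    tauto
  · intro a _
    exact Nat.sub_le _ _
  · intro a ha b hb
    simp only [mem_filter, mem_range, mem_sdiff] at ha hb
    rcases h.units b hb.1.1 with hT | hT
    · exact absurd ⟨hb.1.1, hb.1.2, hT⟩ hb.2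
    · exact h.greedy a ha.1 b hb.1.1 ha.2.1 ha.2.2 hT.1
  · rintro ⟨a, ha⟩
    simp only [mem_filter, mem_range] at ha
    -- An unserved candidate rules out new clusters, so the old labels carry all `N` units.
    have hnew := h.greedy_new a ha.1 ha.2.1 ha.2.2
    have hsum : ∑ j ∈ range n, T j = N := by
      rw [← h.sum_units, two_mul, Finset.sum_range_add]
      simp [hnew]
    have hsn : ∑ j ∈ range n, s j = n := by
      have := hfib fun _ => 1
      simpa using this.symm
    -- The inequality holds cluster by cluster. The first summands on the two sides both add up to
    -- `n` and cancel, leaving the count needed for the greedy exchange.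
    have key : ∑ j ∈ range n, (T j * P +
        if P ≤ 2 * (s j % P) ∧ T j = s j / P then P else 0) ≤
        ∑ j ∈ range n, (s j + if P ≤ 2 * (s j % P) then P - s j % P else 0) := by
      refine Finset.sum_le_sum fun j hj => ?_
      have h1 := Nat.div_add_mod' (s j) P
      have h2 := Nat.mod_lt (s j) h.pos
      rcases h.units j (mem_range.1 hj) with hT | ⟨hT, hr⟩
      · rw [hT]
        split_ifs <;> simp only [hs] at * <;> omega
      · rw [hT, Nat.add_mul, one_mul]
        split_ifs <;> simp only [hs] at * <;> omega
    rw [Finset.sum_add_distrib, Finset.sum_add_distrib, ← Finset.sum_mul, hsum, hsn, h.mul_eq,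
      ← Finset.sum_filter, ← Finset.sum_filter, Finset.sum_const, smul_eq_mul] at key
    exact Nat.le_of_add_le_add_left key

/-- A greedy rounding is within a constant factor of every fair labeling. -/
theorem sum_disagree_le (h : GreedyRounding color f N P p T keep out) {g : Fin n → ℕ} {t : Fin n → ℕ} (ht : ∀ u, 1 ≤ t u)
    (hg : ∀ u c, #{v | g v = g u ∧ color v = c} = t u * p c) :
    ∑ u, #(disagree f out u) ≤ 28 * ∑ u, #(disagree f g u) := by
  have hlow u := imbalance_le_card_disagree color (f := f) u (hg u)
  have hsz (u : Fin n) : #{v | f v = f u} = ∑ c, #{v | f v = f u ∧ color v = c} :=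
    card_eq_sum_color color _
  -- The points moved out of or into the cluster of `u`.
  have hD (u : Fin n) : #{v | ¬ keep v ∧ f v = f u} + #{v | ¬ keep v ∧ out v = f u} ≤
      3 * #(disagree f g u) +
        if P ≤ 2 * (#{w | f w = f u} % P) ∧ T (f u) = #{w | f w = f u} / P then P else 0 := by
    have h1 := h.card_moved (h.label_lt u)
    have h2 := imbalance_round_le (t u) (hsz u) h.sum_eq h.pos (h.units _ (h.label_lt u))
    have h3 := hlow u
    split_ifs at h2 ⊢ <;> omega
  have hU (u : Fin n) : (if P ≤ 2 * (#{w | f w = f u} % P) then P - #{w | f w = f u} % P else 0) ≤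
      #(disagree f g u) := by
    split_ifs with hr
    · have h1 := sub_mod_le_imbalance (t := t u) (hsz u) h.sum_eq hr
      have h2 := hlow u
      omega
    · exact Nat.zero_le _
  -- An old target cluster at most doubles. A new one has at most `P` points, charged to the old
  -- cluster of `u` if that has at least $P/2$ points, and otherwise to the imbalance.
  have hM (u : Fin n) : #(disagree f out u) ≤
      3 * #{v | f v = f u} + 2 * #{v | f v = out u} + 2 * #(disagree f g u) := by
    have h1 := card_disagree_le (f := f) (g := out) u
    rw [h.card_out_eq (h.out_lt u)] at h1
    rcases Nat.lt_or_ge (out u) n with ho | ho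
    · have := h.units_mul_le ho
      omega
    · have h2 : T (out u) * P ≤ P := by
        have := Nat.mul_le_mul_right P (h.units_new _ ho)
        omega
      rcases Nat.lt_or_ge (2 * #{v | f v = f u}) P with hlt | hge
      · have h3 := le_two_mul_imbalance (hsz u) h.sum_eq (ht u) hlt
        have h4 := hlow u
        omega
      · omega
  set M : Finset (Fin n) := {u | ¬ keep u} with hMdef
  have h1 := sum_disagree_le_of_kept (f := f) (g := out) M fun u hu =>
    h.out_eq u (by simpa [hMdef] using hu)
  have h2 : ∑ u ∈ M, #(disagree f out u) ≤ 3 * ∑ u ∈ M, #{v | f v = f u} +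
      2 * ∑ u ∈ M, #{v | f v = out u} + 2 * ∑ u, #(disagree f g u) := by
    calc _ ≤ ∑ u ∈ M, (3 * #{v | f v = f u} + 2 * #{v | f v = out u} +
          2 * #(disagree f g u)) := Finset.sum_le_sum fun u _ => hM u
      _ = 3 * ∑ u ∈ M, #{v | f v = f u} + 2 * ∑ u ∈ M, #{v | f v = out u} +
          2 * ∑ u ∈ M, #(disagree f g u) := by
          simp only [Finset.sum_add_distrib, Finset.mul_sum]
      _ ≤ _ := by
          have := Finset.sum_le_sum_of_subset (f := fun u => #(disagree f g u))
            (Finset.subset_univ M)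
          omega
  -- Double counting turns sums of cluster sizes over moved points into sums over all points `v` of
  -- the numbers of points leaving or entering the cluster of `v`, which `hD` controls.
  rw [sum_card_filter_comm M Finset.univ (fun u v => f v = f u),
    sum_card_filter_comm M Finset.univ (fun u v => f v = out u)] at h2
  have h3 (q : Fin n → ℕ) (v : Fin n) : #{u ∈ M | f v = q u} = #{u | ¬ keep u ∧ q u = f v} := by
    rw [hMdef, Finset.filter_filter]
    simp only [eq_comm]
  rw [Finset.sum_congr rfl fun v _ => h3 f v, Finset.sum_congr rfl fun v _ => h3 out v] at h2
  have h4 := Finset.sum_le_sum fun u (_ : u ∈ Finset.univ) => hD u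
  have h5 := Finset.sum_le_sum fun u (_ : u ∈ Finset.univ) => hU u
  simp only [Finset.sum_add_distrib, ← Finset.mul_sum] at h4
  have h6 := h.sum_rounded_down_le
  -- Points leaving and entering contribute at most $3+1$ times the fair cost, so the total is $2(3
  -- \cdot 4 + 2) = 28$ times it.
  omega

end GreedyRounding

/-! ## Clusterings as labelings -/

section clusterings

variable {n k m : ℕ}

theorem Represents.card_filter {f : Fin n → ℕ} {C : Clustering n} (h : Represents f C)
    {A : Finset (Fin n)} (hA : A ∈ C.parts) {u : Fin n} (hu : u ∈ A) : A = ({v | f v = f u} : Finset (Fin n)) := by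
  ext v
  simp only [mem_filter, mem_univ, true_and]
  rw [h v u]
  refine ⟨fun hv => ⟨A, hA, hv, hu⟩, ?_⟩
  rintro ⟨B, hB, hv, hu'⟩
  rwa [C.eq_of_mem_parts hA hB hu hu']

theorem exists_represents (C : Clustering n) : ∃ f : Fin n → ℕ, Represents f C := by
  refine ⟨fun v => Fintype.equivFin (Finset (Fin n)) (C.part v), fun u v => ?_⟩
  rw [Together, ← C.mem_part_iff_exists,
    C.mem_part_iff_part_eq_part (Finset.mem_univ u) (Finset.mem_univ v), ← Fin.ext_iff]
  exact (Fintype.equivFin _).injective.eq_iff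

theorem exists_represented (f : Fin n → ℕ) : ∃ C : Clustering n, Represents f C := by
  refine ⟨Finpartition.ofSetoid (Setoid.ker f), fun u v => ?_⟩
  rw [Together, ← Finpartition.mem_part_iff_exists, Finpartition.mem_part_ofSetoid_iff_rel,
    Setoid.ker_def, eq_comm]

theorem two_mul_dist {f g : Fin n → ℕ} {C C' : Clustering n} (hf : Represents f C)
    (hg : Represents g C') : 2 * dist C C' = ∑ u, #(disagree f g u) := by
  have h1 : dist C C' = ∑ u, #{v | u < v ∧ v ∈ disagree f g u} := by
    rw [dist, Finset.card_filter, ← Finset.univ_product_univ, Finset.sum_product]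
    refine Finset.sum_congr rfl fun u _ => ?_
    rw [← Finset.card_filter]
    congr 1
    ext v
    simp only [disagree, mem_filter, mem_univ, true_and, hf u v, hg u v]
    tauto
  have h2 : ∑ u, #{v | u < v ∧ v ∈ disagree f g u} = ∑ u, #{v | v < u ∧ v ∈ disagree f g u} := by
    rw [sum_card_filter_comm]
    refine Finset.sum_congr rfl fun u _ => congrArg _ ?_
    ext v
    simp [disagree, eq_comm]
  have h3 : 2 * dist C C' = ∑ u, (#{v | u < v ∧ v ∈ disagree f g u} +
      #{v | v < u ∧ v ∈ disagree f g u}) := by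
    rw [Finset.sum_add_distrib, ← h2, ← h1, two_mul]
  rw [h3]
  refine Finset.sum_congr rfl fun u _ => ?_
  rw [← Finset.card_union_of_disjoint]
  · congr 1
    ext v
    simp only [disagree, mem_union, mem_filter, mem_univ, true_and]
    rcases lt_trichotomy u v with huv | rfl | huv
    · simp [huv]
    · simp
    · simp [huv]
  · rw [Finset.disjoint_left]
    intro v
    simp only [mem_filter, mem_univ, true_and]
    exact fun h h' => lt_asymm h.1 h'.1

theorem dist_comm (C C' : Clustering n) : dist C C' = dist C' C := by
  unfold dist
  congr 1
  ext q
  simp only [mem_filter, mem_univ, true_and]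
  tauto

theorem dist_triangle (C C' C'' : Clustering n) : dist C C'' ≤ dist C C' + dist C' C'' := by
  unfold dist
  refine le_trans (Finset.card_le_card fun q hq => ?_) (Finset.card_union_le _ _)
  simp only [mem_filter, mem_univ, true_and, mem_union] at hq ⊢
  tauto

/-! ## Fair clusterings -/

/-- Fairness gives $|A_c|\,P = |A|\,p_c$ for a cluster $A$. Since `hgcd` makes the $p_c$ coprime,
$P$ divides $|A|$, and the quotient is the number of units. -/
theorem IsFair.exists_units {color : Fin n → Fin k} {G : Clustering n} (hG : IsFair color G)
    {g : Fin n → ℕ} (hg : Represents g G) {N P : ℕ} {p : Fin k → ℕ} (hN : 0 < N) (hP : 0 < P)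
    (hn : N * P = n) (hp : ∀ c, N * p c = #{v | color v = c})
    (hgcd : ∀ d, (∀ c, d ∣ #{v | color v = c}) → d ∣ N) (u : Fin n) :
    ∃ t, 1 ≤ t ∧ ∀ c, #{v | g v = g u ∧ color v = c} = t * p c := by
  set A : Finset (Fin n) := {v | g v = g u} with hA
  have hAG : A ∈ G.parts := by
    rw [hA, ← hg.card_filter (G.part_mem.2 (Finset.mem_univ u)) (G.mem_part (Finset.mem_univ u))]
    exact G.part_mem.2 (Finset.mem_univ u)
  have hfair := hG A hAG
  have hcount (c : Fin k) : #{v | g v = g u ∧ color v = c} = colorCount color c A := by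
    rw [colorCount, hA, Finset.filter_filter]
  have hsumA : ∑ c, colorCount color c A = #A := by
    rw [hA, card_eq_sum_color color]
    exact Finset.sum_congr rfl fun c _ => (hcount c).symm
  have hsum : ∑ c, colorCount color c Finset.univ = n := by
    have := card_eq_sum_color color fun _ => True
    simpa [colorCount] using this.symm
  have h1 (c : Fin k) : colorCount color c A * P = #A * p c := by
    have h2 : colorCount color c A * n = #A * colorCount color c Finset.univ := by
      calc colorCount color c A * n
          = colorCount color c A * ∑ c', colorCount color c' Finset.univ := by rw [hsum]
        _ = _ := by
          rw [← hsumA, Finset.sum_mul, Finset.mul_sum]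
          exact Finset.sum_congr rfl fun c' _ => hfair c c'
    have h3 : colorCount color c Finset.univ = N * p c := (hp c).symm
    refine Nat.eq_of_mul_eq_mul_left hN ?_
    calc N * (colorCount color c A * P) = colorCount color c A * (N * P) := by ring
      _ = N * (#A * p c) := by rw [hn, h2, h3]; ring
  have hgcd1 : Finset.univ.gcd p = 1 := by
    have : N * Finset.univ.gcd p ∣ N * 1 := by
      rw [mul_one]
      refine hgcd _ fun c => ?_
      rw [← hp c]
      exact Nat.mul_dvd_mul_left _ (Finset.gcd_dvd (Finset.mem_univ c))
    exact Nat.dvd_one.1 (Nat.dvd_of_mul_dvd_mul_left hN this)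
  have hdvd : P ∣ #A := by
    have : P ∣ Finset.univ.gcd fun c => #A * p c :=
      Finset.dvd_gcd fun c _ => ⟨_, by rw [← h1 c, mul_comm]⟩
    simpa [Finset.gcd_mul_left, hgcd1] using this
  obtain ⟨t, ht⟩ := hdvd
  have hu : 0 < #A := Finset.card_pos.2 ⟨u, by simp [hA]⟩
  refine ⟨t, Nat.pos_of_ne_zero fun h0 => ?_, fun c => ?_⟩
  · rw [h0, mul_zero] at ht
    omega
  · refine Nat.eq_of_mul_eq_mul_left hP ?_
    rw [hcount]
    have := h1 c
    rw [ht] at this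
    linarith

theorem GreedyRounding.isFair {color : Fin n → Fin k} {f : Fin n → ℕ} {N P : ℕ}
    {p : Fin k → ℕ} {T : ℕ → ℕ} {keep : Fin n → Prop} {out : Fin n → ℕ}
    (h : GreedyRounding color f N P p T keep out) {F : Clustering n} (hF : Represents out F) :
    IsFair color F := by
  intro A hA c c'
  obtain ⟨u, hu⟩ := F.nonempty_of_mem_parts hA
  have h1 (c : Fin k) : colorCount color c A = T (out u) * p c := by
    rw [colorCount, hF.card_filter hA hu, Finset.filter_filter, h.card_out _ (h.out_lt u)]
  have h2 (c : Fin k) : colorCount color c Finset.univ = N * p c := (h.mul_color c).symm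
  rw [h1, h1, h2, h2]
  ring

theorem GreedyRounding.dist_le {color : Fin n → Fin k} {f : Fin n → ℕ} {N P : ℕ}
    {p : Fin k → ℕ} {T : ℕ → ℕ} {keep : Fin n → Prop} {out : Fin n → ℕ}
    (h : GreedyRounding color f N P p T keep out)
    (hgcd : ∀ d, (∀ c, d ∣ #{v | color v = c}) → d ∣ N) {C F G : Clustering n}
    (hC : Represents f C) (hF : Represents out F) (hG : IsFair color G) :
    dist C F ≤ 28 * dist C G := by
  obtain ⟨g, hg⟩ := exists_represents G
  choose t ht1 ht using hG.exists_units hg h.pos_units h.pos h.mul_eq h.mul_color hgcd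
  have h1 := h.sum_disagree_le (g := g) ht1 ht
  rw [← two_mul_dist hC hF, ← two_mul_dist hC hg] at h1
  omega

/-! ## The consensus objective -/

/-- Here $(a+M)^\ell \le 2^\ell(a^\ell+M^\ell)$, and the power mean inequality turns the bound on
$mM$ into $mM^\ell \le K^\ell \sum_j a_j^\ell$. As $1+K^\ell \le (1+K)^\ell$, the $\ell$-th root
removes every dependence on $\ell$. -/
theorem objective_le_mul {ℓ : ℕ} (hℓ : 1 ≤ ℓ) (hm : 1 ≤ m) {C : Fin m → Clustering n}
    {F G : Clustering n} {M K : ℕ} (h : ∀ j, dist (C j) F ≤ dist (C j) G + M)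
    (hM : m * M ≤ K * ∑ j, dist (C j) G) :
    objective ℓ C F ≤ (2 * (1 + K)) * objective ℓ C G := by
  obtain ⟨p, rfl⟩ := Nat.exists_eq_add_of_le' hℓ
  set S : ℝ := ∑ j, (dist (C j) G : ℝ) ^ (p + 1) with hS
  have hS0 : 0 ≤ S := Finset.sum_nonneg fun j _ => by positivity
  have hmpos : (0 : ℝ) < m := by exact_mod_cast hm
  have h1 : (m : ℝ) * (M : ℝ) ^ (p + 1) ≤ (K : ℝ) ^ (p + 1) * S := by
    have h2 := pow_sum_div_card_le_sum_pow (s := Finset.univ)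
      (f := fun j => (dist (C j) G : ℝ)) (fun j _ => by positivity) p
    rw [Finset.card_univ, Fintype.card_fin, div_le_iff₀ (by positivity)] at h2
    have h3 : ((m : ℝ) * M) ^ (p + 1) ≤ (K * ∑ j, (dist (C j) G : ℝ)) ^ (p + 1) := by
      exact pow_le_pow_left₀ (by positivity) (by exact_mod_cast hM) _
    rw [mul_pow, mul_pow] at h3
    have h4 : (K : ℝ) ^ (p + 1) * (∑ j, (dist (C j) G : ℝ)) ^ (p + 1) ≤
        (K : ℝ) ^ (p + 1) * (S * m ^ p) := by gcongr
    have h5 : (m : ℝ) ^ p * (m * (M : ℝ) ^ (p + 1)) ≤ (m : ℝ) ^ p * ((K : ℝ) ^ (p + 1) * S) := by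
      calc _ = (m : ℝ) ^ (p + 1) * (M : ℝ) ^ (p + 1) := by ring
        _ ≤ _ := h3.trans h4
        _ = _ := by ring
    exact le_of_mul_le_mul_left h5 (by positivity)
  have h2 : ∑ j, (dist (C j) F : ℝ) ^ (p + 1) ≤ (2 * (1 + K) : ℝ) ^ (p + 1) * S := by
    calc ∑ j, (dist (C j) F : ℝ) ^ (p + 1)
        ≤ ∑ j, 2 ^ (p + 1) * ((dist (C j) G : ℝ) ^ (p + 1) + (M : ℝ) ^ (p + 1)) := by
          refine Finset.sum_le_sum fun j _ => ?_
          have h3 : (dist (C j) F : ℝ) ≤ 2 * max (dist (C j) G : ℝ) M := by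
            have h4 : (dist (C j) F : ℝ) ≤ dist (C j) G + M := by exact_mod_cast h j
            have := le_max_left (dist (C j) G : ℝ) M
            have := le_max_right (dist (C j) G : ℝ) M
            linarith
          calc (dist (C j) F : ℝ) ^ (p + 1) ≤ (2 * max (dist (C j) G : ℝ) M) ^ (p + 1) := by gcongr
            _ = 2 ^ (p + 1) * (max (dist (C j) G : ℝ) M) ^ (p + 1) := mul_pow _ _ _
            _ ≤ _ := by
              gcongr
              rcases max_cases (dist (C j) G : ℝ) M with ⟨e, _⟩ | ⟨e, _⟩ <;> rw [e]
              · have : (0 : ℝ) ≤ (M : ℝ) ^ (p + 1) := by positivity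
                linarith
              · have : (0 : ℝ) ≤ (dist (C j) G : ℝ) ^ (p + 1) := by positivity
                linarith
      _ = 2 ^ (p + 1) * (S + m * (M : ℝ) ^ (p + 1)) := by
          rw [← Finset.mul_sum, Finset.sum_add_distrib, Finset.sum_const, Finset.card_univ,
            Fintype.card_fin, nsmul_eq_mul]
      _ ≤ 2 ^ (p + 1) * (S + (K : ℝ) ^ (p + 1) * S) := by gcongr
      _ = 2 ^ (p + 1) * ((1 ^ (p + 1) + (K : ℝ) ^ (p + 1)) * S) := by ring
      _ ≤ 2 ^ (p + 1) * ((1 + K : ℝ) ^ (p + 1) * S) := by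
          gcongr
          exact pow_add_pow_le zero_le_one (by positivity) (by omega)
      _ = _ := by rw [mul_pow]; ring
  have h3 : (0 : ℝ) ≤ ∑ j, (dist (C j) F : ℝ) ^ (p + 1) :=
    Finset.sum_nonneg fun j _ => by positivity
  unfold objective
  calc (∑ j, (dist (C j) F : ℝ) ^ (p + 1)) ^ ((1 : ℝ) / ((p + 1 : ℕ) : ℝ))
      ≤ ((2 * (1 + K) : ℝ) ^ (p + 1) * S) ^ ((1 : ℝ) / ((p + 1 : ℕ) : ℝ)) :=
        Real.rpow_le_rpow h3 h2 (by positivity)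
    _ = _ := by
        rw [Real.mul_rpow (by positivity) hS0, one_div,
          Real.pow_rpow_inv_natCast (by positivity) (by omega)]

/-- Rounding the input clustering with the smallest total distance to the others. -/
theorem objective_le_of_median {ℓ : ℕ} (hℓ : 1 ≤ ℓ) (hm : 1 ≤ m) {C : Fin m → Clustering n}
    {F G : Clustering n} (i : Fin m)
    (hi : ∀ i', ∑ j, dist (C i) (C j) ≤ ∑ j, dist (C i') (C j))
    (hF : dist (C i) F ≤ 28 * dist (C i) G) :
    objective ℓ C F ≤ 176 * objective ℓ C G := by
  -- The minimum over `i'` is at most the average, and the triangle inequality through `G` bounds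
  -- the average.
  have h1 : m * ∑ j, dist (C i) (C j) ≤ 2 * (m * ∑ j, dist (C j) G) := by
    calc m * ∑ j, dist (C i) (C j) = ∑ _i' : Fin m, ∑ j, dist (C i) (C j) := by simp
      _ ≤ ∑ i', ∑ j, (dist (C i') G + dist (C j) G) :=
        Finset.sum_le_sum fun i' _ => (hi i').trans <| Finset.sum_le_sum fun j _ => by
          rw [dist_comm (C j) G]
          exact dist_triangle _ _ _
      _ = _ := by
        simp only [Finset.sum_add_distrib, Finset.sum_const, Finset.card_univ, Fintype.card_fin,
          smul_eq_mul, ← Finset.mul_sum]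
        ring
  have h2 : ∑ j, dist (C i) (C j) ≤ 2 * ∑ j, dist (C j) G :=
    Nat.le_of_mul_le_mul_left (h1.trans (by rw [mul_left_comm])) hm
  have h3 : m * dist (C i) G ≤ 3 * ∑ j, dist (C j) G := by
    calc m * dist (C i) G = ∑ _j : Fin m, dist (C i) G := by simp
      _ ≤ ∑ j, (dist (C i) (C j) + dist (C j) G) :=
        Finset.sum_le_sum fun j _ => dist_triangle _ _ _
      _ ≤ _ := by
        rw [Finset.sum_add_distrib]
        omega
  -- $29 = 1 + 28$ for the detour through `G` and the rounding, $87 = 3 \cdot 29$ by `h3`, and $176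
  -- = 2(1+87)$.
  have h4 := objective_le_mul (K := 87) (M := 29 * dist (C i) G) hℓ hm (C := C) (F := F) (G := G)
    (fun j => ?_) (by linarith)
  · norm_num at h4
    exact h4
  · have h5 := dist_triangle (C j) (C i) F
    have h6 := dist_triangle (C j) G (C i)
    rw [dist_comm G] at h6
    omega

theorem IsApproxFairConsensus.of_median {ℓ : ℕ} (hℓ : 1 ≤ ℓ) (hm : 1 ≤ m)
    {color : Fin n → Fin k} {C : Fin m → Clustering n} {F : Clustering n} (i : Fin m)
    (hi : ∀ i', ∑ j, dist (C i) (C j) ≤ ∑ j, dist (C i') (C j)) (hfair : IsFair color F)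
    (hF : ∀ G, IsFair color G → dist (C i) F ≤ 28 * dist (C i) G) {β : ℝ} (hβ : 176 ≤ β) :
    IsApproxFairConsensus ℓ color C β F :=
  ⟨hfair, fun G hG => (objective_le_of_median hℓ hm i hi (hF G hG.1)).trans <|
    mul_le_mul_of_nonneg_right hβ <| Real.rpow_nonneg
      (Finset.sum_nonneg fun j _ => by positivity) _⟩

end clusterings

/-! ### Comparison of the constant with the stated factors -/

theorem le_mul_rpow_colors {k : ℕ} (hk : 1 ≤ k) : (176 : ℝ) ≤ 1000 * (k : ℝ) ^ (3.8 : ℝ) := by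
  have : (1 : ℝ) ≤ (k : ℝ) ^ (3.8 : ℝ) :=
    Real.one_le_rpow (by exact_mod_cast hk) (by norm_num)
  linarith

theorem le_mul_rpow_log_colors {k : ℕ} (hk : 2 ≤ k) :
    (176 : ℝ) ≤ 1000 * ((k : ℝ) ^ (1.6 : ℝ) * Real.log k ^ (2.8 : ℝ)) := by
  have hk' : (2 : ℝ) ≤ k := by exact_mod_cast hk
  have h1 : (1 : ℝ) ≤ (k : ℝ) ^ (1.6 : ℝ) := Real.one_le_rpow (by linarith) (by norm_num)
  -- For $k = 2$ the logarithm is below one, so its power is bounded below by $0.69^3 \ge 0.3$ only.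
  have h2 : (0.69 : ℝ) ≤ Real.log k :=
    le_trans (by linarith [Real.log_two_gt_d9]) (Real.log_le_log (by norm_num) hk')
  have h3 : (0.69 : ℝ) ^ (3 : ℝ) ≤ Real.log k ^ (2.8 : ℝ) :=
    (Real.rpow_le_rpow_of_exponent_ge (by norm_num) (by norm_num) (by norm_num)).trans
      (Real.rpow_le_rpow (by norm_num) h2 (by norm_num))
  have h4 : (0.3 : ℝ) ≤ (0.69 : ℝ) ^ (3 : ℝ) := by
    rw [show (3 : ℝ) = ((3 : ℕ) : ℝ) by norm_num, Real.rpow_natCast]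
    norm_num
  nlinarith

/-! ## Cluster sizes, unit size and target numbers of units

Register `23` holds the position at which the labels `lab` of the chosen clustering begin. -/

/-- The numerical assumptions under which the rounding program runs. -/
structure Setting (W n k base : ℕ) (col lab L : ℕ → ℕ) : Prop where
  n_pos : 1 ≤ n
  col_lt : ∀ v < n, col v < k
  lab_lt : ∀ v < n, lab v < n
  lab_eq : ∀ v, lab v = L (base + v)
  base_lt : base + n < W
  -- The term $2nk$ covers the addresses $jk + c$ with $j < 2n$, and $n^2$ covers the capacities
  -- $T_j p_c$.
  bound : 2 * n * k + k + n * n + 4 * n + 10 < W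

/-- The registers and banks that stay fixed during rounding. -/
structure Ready (n k base : ℕ) (col L : ℕ → ℕ) (s : State) : Prop where
  reg0 : s.reg 0 = n
  reg2 : s.reg 2 = k
  reg4 : s.reg 4 = 1
  reg5 : s.reg 5 = 0
  reg23 : s.reg 23 = base
  bank0 : ∀ v < n, s.bank 0 v = col v
  bank1 : s.bank 1 = L

theorem Ready.of_agree {n k base : ℕ} {col L : ℕ → ℕ} {s s' : State} {rs bs : List ℕ}
    (h : Ready n k base col L s) (ha : Agree rs bs s s') (hr : ∀ r ∈ [0, 2, 4, 5, 23], r ∉ rs)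
    (hb : ∀ b ∈ [0, 1], b ∉ bs) : Ready n k base col L s' where
  reg0 := (ha.reg 0 (hr 0 (by decide))).trans h.reg0
  reg2 := (ha.reg 2 (hr 2 (by decide))).trans h.reg2
  reg4 := (ha.reg 4 (hr 4 (by decide))).trans h.reg4
  reg5 := (ha.reg 5 (hr 5 (by decide))).trans h.reg5
  reg23 := (ha.reg 23 (hr 23 (by decide))).trans h.reg23
  bank0 v hv := (congrFun (ha.bank 0 (hb 0 (by decide))) v).trans (h.bank0 v hv)
  bank1 := (ha.bank 1 (hb 1 (by decide))).trans h.bank1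

def countStep : Prog := block [
  .op .add 14 23 10, .load 14 1 14, .load 15 4 14, .op .add 15 15 4, .store 4 14 15,
  .load 14 0 10, .load 15 5 14, .op .add 15 15 4, .store 5 14 15]

/-- Bank `4` receives the cluster sizes and bank `5` the sizes of the color classes. -/
def countLoop : Prog := forLoop 10 0 countStep

/-- The test runs over the points and not over the colors: absent colors have class size zero, and
`k` stays out of the running time. -/
def dividesStep : Prog := block [
  .load 16 0 11, .load 16 5 16, .op .mod 16 16 14, .ite (.eq 16 5) .skip (.const 15 0)]

/-- Candidates increase, so the last common divisor recorded is the greatest. -/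
def gcdStep : Prog := block [
  .op .add 14 10 4, .const 15 1, forLoop 11 0 dividesStep, .ite (.eq 15 4) (.op .add 30 14 5) .skip]

/-- Register `30` receives the greatest common divisor of the sizes of the color classes. -/
def gcdLoop : Prog := block [.const 30 1, forLoop 10 0 gcdStep]

def quotStep : Prog := block [
  .load 14 4 10, .op .div 15 14 31, .store 6 10 15, .op .sub 32 32 15, .op .mod 16 14 31,
  .op .add 16 16 16, .ite (.lt 16 31) .skip (.store 7 10 4)]

/-- Bank `6` receives the numbers of whole units in the clusters, bank `7` marks the clusters that
may be rounded up, and register `32` receives the number of remaining units. -/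
def quotLoop : Prog := block [
  .op .div 31 0 30, .op .add 33 0 0, .op .add 32 30 5, forLoop 10 0 quotStep]

def findStep : Prog := block [
  .load 16 7 11,
  .ite (.eq 16 4)
    (block [.load 17 4 11, .ite (.lt 14 17) (block [.op .add 14 17 5, .op .add 15 11 5]) .skip])
    .skip]

/-- Register `14` holds the largest marked size, with `0` for no marked cluster. The counter in
register `10` makes `n + reg 10` a fresh label. -/
def roundStep : Prog := block [
  .const 14 0, .const 15 0, forLoop 11 0 findStep,
  .ite (.eq 14 5) (block [.op .add 15 0 10, .store 6 15 4])
    (block [.load 17 6 15, .op .add 17 17 4, .store 6 15 17, .store 7 15 5])]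

/-- Every remaining unit goes to the largest marked cluster, or to a new one. -/
def roundLoop : Prog := forLoop 10 32 roundStep

/-! ### Correctness of the counting loops and of the distribution of units -/

section phases

variable {W n k base : ℕ} {col lab L : ℕ → ℕ} {s : State}

theorem countLoop_wp (hS : Setting W n k base col lab L) (hR : Ready n k base col L s)
    (h4 : ∀ a, s.bank 4 a = 0) (h5 : ∀ a, s.bank 5 a = 0) :
    WP W countLoop s (fun t s' => t ≤ 24 * n ∧
      (∀ a, s'.bank 4 a = Nat.count (fun v => lab v = a) n) ∧
      (∀ c, s'.bank 5 c = Nat.count (fun v => col v = c) n)) := by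
  have hb := hS.bound
  refine (wp_forLoop (L := n) (M := n) (τ := 20) (fun i s' =>
      (∀ a, s'.bank 4 a = Nat.count (fun v => lab v = a) i) ∧
      (∀ c, s'.bank 5 c = Nat.count (fun v => col v = c) i)) hR.reg0 hR.reg4 (by omega) le_rfl
      hS.n_pos (by decide) (by decide) (by decide) (by simp) (by simpa using ⟨h4, h5⟩) ?_).mono
      (fun t s' h => ⟨h.1, h.2.1⟩)
  intro i s' hi hr ha ⟨hI4, hI5⟩
  have hR' := hR.of_agree ha (by decide) (by decide)
  have e1 : L (base + i) = lab i := (hS.lab_eq i).symm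
  have b1 := hS.lab_lt i hi
  have b2 := hS.col_lt i hi
  have b3 := hS.base_lt
  have c1 := Nat.count_le (p := fun v => lab v = lab i) (n := i)
  have c2 := Nat.count_le (p := fun v => col v = col i) (n := i)
  have d1 : base + i < W := by omega
  have d2 : lab i < W := by omega
  have d3 : col i < W := by omega
  have d4 : Nat.count (fun v => lab v = lab i) i + 1 < W := by omega
  have d5 : Nat.count (fun v => col v = col i) i + 1 < W := by omega
  simp [countStep, Op.eval, hR'.reg4, hR'.reg23, hR'.bank1, hr, e1, hI4, hI5,
    hR'.bank0 i hi, d1, d2, d3, d4, d5, Nat.lt_of_succ_lt d4, Nat.lt_of_succ_lt d5]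
  refine ⟨fun a => ?_, fun c => ?_⟩
  · by_cases h : a = lab i
    · simp [h, Nat.count_succ]
    · rw [Function.update_of_ne h, hI4, Nat.count_succ, if_neg (Ne.symm h), add_zero]
  · by_cases h : c = col i
    · simp [h, Nat.count_succ]
    · rw [Function.update_of_ne h, hI5, Nat.count_succ, if_neg (Ne.symm h), add_zero]

theorem dividesLoop_wp {cc : ℕ → ℕ} {d : ℕ} (hS : Setting W n k base col lab L)
    (hR : Ready n k base col L s)
    (h5 : s.bank 5 = cc) (hcc : ∀ c, cc c ≤ n) (hd : s.reg 14 = d) (h15 : s.reg 15 = 1) :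
    WP W (forLoop 11 0 dividesStep) s (fun t s' => t ≤ 24 * n ∧
      ((s'.reg 15 = 1 ∧ ∀ v < n, d ∣ cc (col v)) ∨
        (s'.reg 15 = 0 ∧ ¬ ∀ v < n, d ∣ cc (col v)))) := by
  have hb := hS.bound
  refine (wp_forLoop (L := n) (M := n) (τ := 20) (fun i s' =>
      (s'.reg 15 = 1 ∧ ∀ v < i, d ∣ cc (col v)) ∨
        (s'.reg 15 = 0 ∧ ¬ ∀ v < i, d ∣ cc (col v))) hR.reg0 hR.reg4 (by omega) le_rfl
      hS.n_pos (by decide) (by decide) (by decide) (by simp) (by simpa using h15) ?_).mono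
      (fun t s' h => ⟨h.1, h.2.1⟩)
  intro i s' hi hr ha hI
  have hR' := hR.of_agree ha (by decide) (by decide)
  have g5 := (ha.bank 5 (by decide)).trans h5
  have g14 := (ha.reg 14 (by decide)).trans hd
  have b2 := hS.col_lt i hi
  have b3 := hcc (col i)
  have b4 := Nat.mod_le (cc (col i)) d
  have d1 : col i < W := by omega
  have d2 : cc (col i) < W := by omega
  have d3 : cc (col i) % d < W := by omega
  simp [dividesStep, Op.eval, Test.Holds, hR'.reg5, hR'.bank0 i hi, hr, g5, g14, d1, d2, d3,
    -Order.lt_add_one_iff, -not_forall]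
  refine ⟨fun hdvd => ?_, fun hdvd => ⟨by omega, ?_⟩⟩
  · rw [← Nat.dvd_iff_mod_eq_zero] at hdvd
    refine hI.imp (And.imp_right fun h v hv => ?_) (And.imp_right fun h h' => ?_)
    · rcases Nat.lt_succ_iff_lt_or_eq.1 hv with hv | rfl
      · exact h v hv
      · exact hdvd
    · exact h fun v hv => h' v (by omega)
  · rw [← Nat.dvd_iff_mod_eq_zero] at hdvd
    exact fun h => hdvd (h i (by omega))

theorem gcdLoop_wp {cc : ℕ → ℕ} (hS : Setting W n k base col lab L)
    (hR : Ready n k base col L s) (h5 : s.bank 5 = cc) (hcc : ∀ c, cc c ≤ n) :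
    WP W gcdLoop s (fun t s' => t ≤ 100 * n ^ 2 ∧ 1 ≤ s'.reg 30 ∧
      (∀ v < n, s'.reg 30 ∣ cc (col v)) ∧
      ∀ d, 1 ≤ d → d ≤ n → (∀ v < n, d ∣ cc (col v)) → d ≤ s'.reg 30) := by
  have hb := hS.bound
  have hn1 := hS.n_pos
  unfold gcdLoop
  rw [wp_block_cons, wp_const]
  refine ⟨by omega, ?_⟩
  rw [wp_block_cons]
  refine (wp_forLoop (L := n) (M := n) (τ := 24 * n + 20) (fun i s' => 1 ≤ s'.reg 30 ∧
      (∀ v < n, s'.reg 30 ∣ cc (col v)) ∧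
      ∀ d, 1 ≤ d → d ≤ i → (∀ v < n, d ∣ cc (col v)) → d ≤ s'.reg 30) (by simpa using hR.reg0)
      (by simpa using hR.reg4) (by omega) le_rfl
      hS.n_pos (by decide) (by decide) (by decide) (by simp) ?_ ?_).mono ?_
  · refine ⟨by simp, by simp, ?_⟩
    intro d h1 h2
    omega
  · intro i s' hi hr ha ⟨hI1, hI2, hI3⟩
    have hR' : Ready n k base col L s' :=
      (Ready.of_agree (s' := s.setReg 30 1) (rs := [30]) (bs := []) hR
        ⟨fun r hr => by simp_all, fun _ _ => rfl⟩ (by decide) (by decide)).of_agree ha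
        (by decide) (by decide)
    have d1 : i + 1 < W := by omega
    unfold gcdStep
    simp only [wp_block_cons, wp_op, wp_const, hr, hR'.reg4, Op.eval]
    refine ⟨d1, by omega, ?_⟩
    have hR'' : Ready n k base col L ((s'.setReg 14 (i + 1)).setReg 15 1) :=
      Ready.of_agree (rs := [14, 15]) (bs := []) hR'
        ⟨fun r hr => by simp_all, fun _ _ => rfl⟩ (by decide) (by decide)
    refine (dividesLoop_wp (d := i + 1) hS hR'' ((ha.bank 5 (by decide)).trans h5) hcc (by simp)
      (by simp)).frame.mono ?_
    rintro t s₂ ⟨⟨ht, h⟩, ha₂⟩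
    have hR₂ := hR''.of_agree ha₂ (by decide) (by decide)
    have g14 : s₂.reg 14 = i + 1 := (ha₂.reg 14 (by decide)).trans (by simp)
    have g30 : s₂.reg 30 = s'.reg 30 := (ha₂.reg 30 (by decide)).trans (by simp)
    simp [Op.eval, Test.Holds, hR₂.reg4, hR₂.reg5, g14, g30, d1]
    refine ⟨fun h15 => ⟨by omega, ?_, fun d _ hd _ => hd⟩, fun h15 => ⟨by omega, hI1, hI2, ?_⟩⟩
    · rcases h with h | h
      · exact h.2
      · omega
    · intro d hd1 hd hdv
      rcases Nat.lt_or_ge d (i + 1) with hlt | hge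
      · exact hI3 d hd1 (by omega) hdv
      · obtain rfl : d = i + 1 := by omega
        rcases h with h | h
        · omega
        · exact absurd hdv h.2
  · rintro t s' ⟨ht, h, -⟩
    rw [wp_block_nil]
    refine ⟨?_, h⟩
    nlinarith only [ht, hn1]

theorem quotLoop_wp {sz : ℕ → ℕ} {N : ℕ} (hS : Setting W n k base col lab L)
    (hR : Ready n k base col L s) (h4 : s.bank 4 = sz) (hsz : ∀ a, sz a ≤ n)
    (h6 : ∀ a, s.bank 6 a = 0) (h7 : ∀ a, s.bank 7 a = 0) (h30 : s.reg 30 = N) (hN : N ≤ n) :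
    WP W quotLoop s (fun t s' => t ≤ 100 * n ∧ s'.reg 31 = n / N ∧ s'.reg 33 = 2 * n ∧
      s'.reg 32 = N - ∑ a ∈ range n, sz a / (n / N) ∧
      (∀ a, s'.bank 6 a = if a < n then sz a / (n / N) else 0) ∧
      (∀ a, s'.bank 7 a = if a < n ∧ n / N ≤ 2 * (sz a % (n / N)) then 1 else 0)) := by
  have hb := hS.bound
  have hn1 := hS.n_pos
  have hP := Nat.div_le_self n N
  unfold quotLoop
  simp only [wp_block_cons, wp_op, Op.eval, State.setReg_reg, hR.reg0, hR.reg5, h30, if_false,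
    Nat.reduceEqDiff, OfNat.zero_ne_ofNat, add_zero]
  refine ⟨by omega, by omega, by omega, ?_⟩
  set s₁ := ((s.setReg 31 (n / N)).setReg 33 (n + n)).setReg 32 N with hs₁
  have hR₁ : Ready n k base col L s₁ := Ready.of_agree (rs := [31, 32, 33]) (bs := []) hR
      ⟨fun r hr => by simp_all, fun _ _ => rfl⟩ (by decide) (by decide)
  refine (wp_forLoop (L := n) (M := n) (τ := 20) (fun i s' =>
      s'.reg 32 = N - ∑ a ∈ range i, sz a / (n / N) ∧
      (∀ a, s'.bank 6 a = if a < i then sz a / (n / N) else 0) ∧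
      (∀ a, s'.bank 7 a = if a < i ∧ n / N ≤ 2 * (sz a % (n / N)) then 1 else 0)) hR₁.reg0 hR₁.reg4
      (by omega) le_rfl
      hS.n_pos (by decide) (by decide) (by decide) (by simp) (by simp [hs₁, h6, h7]) ?_).mono ?_
  · intro i s' hi hr ha ⟨hI32, hI6, hI7⟩
    have hR' := hR₁.of_agree ha (by decide) (by decide)
    have g4 : s'.bank 4 = sz := (ha.bank 4 (by decide)).trans (by simpa [hs₁] using h4)
    have g31 : s'.reg 31 = n / N := (ha.reg 31 (by decide)).trans (by simp [hs₁])
    have c1 := hsz i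
    have c2 := Nat.div_le_self (sz i) (n / N)
    have c3 := Nat.mod_le (sz i) (n / N)
    have d1 : sz i < W := by omega
    have d2 : sz i / (n / N) < W := by omega
    have d3 : sz i % (n / N) < W := by omega
    have d4 : sz i % (n / N) + sz i % (n / N) < W := by omega
    have d5 : N - ∑ a ∈ range i, sz a / (n / N) - sz i / (n / N) < W :=
      lt_of_le_of_lt ((Nat.sub_le _ _).trans (Nat.sub_le _ _)) (by omega)
    have d7 : N - ∑ a ∈ range (i + 1), sz a / (n / N) =
        N - ∑ a ∈ range i, sz a / (n / N) - sz i / (n / N) := by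
      rw [Finset.sum_range_succ, Nat.sub_sub]
    have d6 : 1 < W := by omega
    have e6 : ∀ a, Function.update (s'.bank 6) i (sz i / (n / N)) a =
        if a < i + 1 then sz a / (n / N) else 0 := by
      intro a
      rw [Function.update_apply, hI6]
      rcases lt_trichotomy a i with h | rfl | h
      · rw [if_neg (by omega), if_pos h, if_pos (by omega)]
      · simp
      · rw [if_neg (by omega), if_neg (by omega), if_neg (by omega)]
    simp [quotStep, Op.eval, Test.Holds, hR'.reg4, hr, g4, g31, hI32, d1, d2, d3, d4, d5, d6, d7,
      e6, -Order.lt_add_one_iff]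
    refine ⟨fun hlt a => ?_, fun hge a => ?_⟩
    · rw [hI7]
      rcases lt_trichotomy a i with h | rfl | h
      · simp [h, Nat.lt_succ_of_lt h]
      · rw [if_neg (by omega), if_neg (by omega)]
      · rw [if_neg (by omega), if_neg (by omega)]
    · rw [Function.update_apply, hI7]
      rcases lt_trichotomy a i with h | rfl | h
      · simp [h, Nat.lt_succ_of_lt h, h.ne]
      · rw [if_pos rfl, if_pos ⟨by omega, by omega⟩]
      · rw [if_neg (by omega), if_neg (by omega), if_neg (by omega)]
  · rintro t s' ⟨ht, h, ha⟩
    rw [wp_block_nil]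
    refine ⟨by omega, (ha.reg 31 (by decide)).trans (by simp [hs₁]),
      (ha.reg 33 (by decide)).trans (by simp [hs₁, two_mul]), h⟩

/-- The numbers of units `T` and the marks `fl` after `i` extra units were distributed. -/
structure PartialRounding (n P : ℕ) (sz T fl : ℕ → ℕ) (i : ℕ) : Prop where
  flag : ∀ a, fl a = if a < n ∧ P ≤ 2 * (sz a % P) ∧ T a = sz a / P then 1 else 0
  units : ∀ a < n, T a = sz a / P ∨ (T a = sz a / P + 1 ∧ P ≤ 2 * (sz a % P))
  units_new : ∀ j, n ≤ j → T j ≤ 1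
  unused : ∀ j, n + i ≤ j → T j = 0
  sum_units : ∑ j ∈ range (2 * n), T j = ∑ a ∈ range n, sz a / P + i
  greedy : ∀ a < n, ∀ b < n, P ≤ 2 * (sz a % P) → T a = sz a / P → T b = sz b / P + 1 →
    sz a ≤ sz b
  greedy_new : ∀ a < n, P ≤ 2 * (sz a % P) → T a = sz a / P → ∀ j, n ≤ j → T j = 0

theorem sum_range_update {N x y : ℕ} {T : ℕ → ℕ} (hx : x < N) (hy : y = T x + 1) :
    ∑ j ∈ range N, Function.update T x y j = ∑ j ∈ range N, T j + 1 := by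
  rw [Finset.sum_update_of_mem (by simpa using hx), hy,
    ← Finset.add_sum_erase (range N) T (by simpa using hx : x ∈ range N), Finset.sdiff_singleton_eq_erase]
  omega

/-- The marks are exactly the candidates not yet served, so choosing a largest marked cluster
preserves the greedy order. -/
theorem PartialRounding.round_up {P i b : ℕ} {sz T fl : ℕ → ℕ}
    (h : PartialRounding n P sz T fl i) (hb : fl b = 1) (hmax : ∀ a < n, fl a = 1 → sz a ≤ sz b) :
    PartialRounding n P sz (Function.update T b (T b + 1)) (Function.update fl b 0) (i + 1) := by
  have hfl (a : ℕ) : fl a = 1 ↔ a < n ∧ P ≤ 2 * (sz a % P) ∧ T a = sz a / P := by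
    rw [h.flag]
    split_ifs with hc <;> simp [hc]
  obtain ⟨hbn, hbP, hbT⟩ := (hfl b).1 hb
  have hnew (j : ℕ) (hj : n ≤ j) : Function.update T b (T b + 1) j = T j := by
    rw [Function.update_of_ne (by omega)]
  have hcand (a : ℕ) (hTa : Function.update T b (T b + 1) a = sz a / P) : T a = sz a / P := by
    rw [Function.update_apply] at hTa
    split_ifs at hTa with hab
    · subst hab
      omega
    · exact hTa
  refine ⟨fun a => ?_, fun a ha => ?_, fun j hj => ?_, fun j hj => ?_, ?_, ?_, ?_⟩
  · rw [Function.update_apply, Function.update_apply]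
    by_cases hab : a = b
    · subst hab
      rw [if_pos rfl, if_pos rfl, if_neg (by omega)]
    · rw [if_neg hab, if_neg hab, h.flag]
  · rw [Function.update_apply]
    split_ifs with hab
    · subst hab
      exact .inr ⟨by omega, hbP⟩
    · exact h.units a ha
  · rw [hnew j hj]
    exact h.units_new j hj
  · rw [hnew j (by omega)]
    exact h.unused j (by omega)
  · rw [sum_range_update (by omega) rfl, h.sum_units, add_assoc]
  · intro a ha c hc haP hTa hTc
    have hTa := hcand a hTa
    rw [Function.update_apply] at hTc
    split_ifs at hTc with hcb
    · rw [hcb]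
      exact hmax a ha ((hfl a).2 ⟨ha, haP, hTa⟩)
    · exact h.greedy a ha c hc haP hTa hTc
  · intro a ha haP hTa j hj
    rw [hnew j hj]
    exact h.greedy_new a ha haP (hcand a hTa) j hj

/-- With no mark left the premises of both greedy clauses are void, and `unused` says that label `n
+ i` is still free. -/
theorem PartialRounding.open_new {P i : ℕ} {sz T fl : ℕ → ℕ}
    (h : PartialRounding n P sz T fl i) (hi : i < n) (hnone : ∀ a < n, fl a ≠ 1) :
    PartialRounding n P sz (Function.update T (n + i) 1) fl (i + 1) := by
  have hold (a : ℕ) (ha : a < n) : Function.update T (n + i) 1 a = T a := by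
    rw [Function.update_of_ne (by omega)]
  have hno (a : ℕ) (ha : a < n) (haP : P ≤ 2 * (sz a % P)) (hTa : T a = sz a / P) : False := by
    refine hnone a ha ?_
    rw [h.flag, if_pos ⟨ha, haP, hTa⟩]
  refine ⟨fun a => ?_, fun a ha => ?_, fun j hj => ?_, fun j hj => ?_, ?_, ?_, ?_⟩
  · rw [h.flag]
    by_cases ha : a < n
    · rw [hold a ha]
    · rw [if_neg (by omega), if_neg (by omega)]
  · rw [hold a ha]
    exact h.units a ha
  · rw [Function.update_apply]
    split_ifs
    · exact le_rfl
    · exact h.units_new j hj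
  · rw [Function.update_of_ne (by omega)]
    exact h.unused j (by omega)
  · rw [sum_range_update (by omega) (by rw [h.unused _ le_rfl]), h.sum_units, add_assoc]
  · intro a ha c hc haP hTa
    rw [hold a ha] at hTa
    exact (hno a ha haP hTa).elim
  · intro a ha haP hTa
    rw [hold a ha] at hTa
    exact (hno a ha haP hTa).elim

theorem findLoop_wp {sz fl : ℕ → ℕ} (hS : Setting W n k base col lab L)
    (hR : Ready n k base col L s) (h4 : s.bank 4 = sz) (hsz : ∀ a, sz a ≤ n)
    (h7 : s.bank 7 = fl) (hfl : ∀ a, fl a ≤ 1) (h14 : s.reg 14 = 0) :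
    WP W (forLoop 11 0 findStep) s (fun t s' => t ≤ 24 * n ∧
      (∀ a < n, fl a = 1 → sz a ≤ s'.reg 14) ∧
      (s'.reg 14 = 0 ∨ (s'.reg 15 < n ∧ fl (s'.reg 15) = 1 ∧ sz (s'.reg 15) = s'.reg 14))) := by
  have hb := hS.bound
  refine (wp_forLoop (L := n) (M := n) (τ := 20) (fun i s' =>
      (∀ a < i, fl a = 1 → sz a ≤ s'.reg 14) ∧
      (s'.reg 14 = 0 ∨ (s'.reg 15 < i ∧ fl (s'.reg 15) = 1 ∧ sz (s'.reg 15) = s'.reg 14)))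
      hR.reg0 hR.reg4 (by omega) le_rfl
      hS.n_pos (by decide) (by decide) (by decide) (by simp) (by simpa using h14) ?_).mono
      (fun t s' h => ⟨h.1, h.2.1⟩)
  intro i s' hi hr ha ⟨hI1, hI2⟩
  have hR' := hR.of_agree ha (by decide) (by decide)
  have g4 := (ha.bank 4 (by decide)).trans h4
  have g7 := (ha.bank 7 (by decide)).trans h7
  have c1 := hsz i
  have c2 := hfl i
  have d1 : sz i < W := by omega
  have d2 : fl i < W := by omega
  have d3 : i < W := by omega
  simp [findStep, Op.eval, Test.Holds, hR'.reg4, hR'.reg5, hr, g4, g7, d1, d2, d3,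
    -Order.lt_add_one_iff]
  have hI2' : s'.reg 14 = 0 ∨
      (s'.reg 15 < i + 1 ∧ fl (s'.reg 15) = 1 ∧ sz (s'.reg 15) = s'.reg 14) :=
    hI2.imp_right fun h => ⟨by omega, h.2⟩
  refine ⟨fun hf => ⟨fun hlt => ⟨fun a ha' hfa => ?_, .inr hf⟩, fun hge =>
    ⟨fun a ha' hfa => ?_, hI2'⟩⟩, fun hf => ⟨fun a ha' hfa => ?_, hI2'⟩⟩ <;>
  rcases Nat.lt_succ_iff_lt_or_eq.1 ha' with h | rfl
  · have := hI1 a h hfa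
    omega
  · exact le_rfl
  · exact hI1 a h hfa
  · omega
  · exact hI1 a h hfa
  · exact absurd hfa hf

theorem roundLoop_wp {sz : ℕ → ℕ} {P R : ℕ} (hS : Setting W n k base col lab L)
    (hR : Ready n k base col L s) (h4 : s.bank 4 = sz) (hsz : ∀ a, sz a ≤ n) (hP : 0 < P)
    (h32 : s.reg 32 = R) (hRn : R ≤ n) (h0 : PartialRounding n P sz (s.bank 6) (s.bank 7) 0) :
    WP W roundLoop s (fun t s' => t ≤ 100 * n ^ 2 ∧
      PartialRounding n P sz (s'.bank 6) (s'.bank 7) R) := by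
  have hb := hS.bound
  have hn1 := hS.n_pos
  refine (wp_forLoop (L := R) (M := n) (τ := 24 * n + 20) (fun i s' =>
      PartialRounding n P sz (s'.bank 6) (s'.bank 7) i) h32 hR.reg4 (by omega) hRn
      hS.n_pos (by decide) (by decide) (by decide) (by simp) h0 ?_).mono
      (fun t s' h => ⟨?_, h.2.1⟩)
  · intro i s' hi hr ha hI
    have hR' := hR.of_agree ha (by decide) (by decide)
    have g4 := (ha.bank 4 (by decide)).trans h4
    have hfl : ∀ a, s'.bank 7 a ≤ 1 := fun a => by
      rw [hI.flag]
      split_ifs <;> omega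
    unfold roundStep
    simp only [wp_block_cons, wp_const]
    refine ⟨by omega, by omega, ?_⟩
    have hR'' : Ready n k base col L ((s'.setReg 14 0).setReg 15 0) :=
      Ready.of_agree (rs := [14, 15]) (bs := []) hR'
        ⟨fun r hr => by simp_all, fun _ _ => rfl⟩ (by decide) (by decide)
    refine (findLoop_wp hS hR'' g4 hsz rfl hfl (by simp)).frame.mono ?_
    rintro t s₂ ⟨⟨ht, hmax, hcase⟩, ha₂⟩
    have hR₂ := hR''.of_agree ha₂ (by decide) (by decide)
    have f6 : s₂.bank 6 = s'.bank 6 := ha₂.bank 6 (by decide)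
    have f7 : s₂.bank 7 = s'.bank 7 := ha₂.bank 7 (by decide)
    have f10 : s₂.reg 10 = i := (ha₂.reg 10 (by decide)).trans (by simpa)
    simp only [State.setReg_bank] at hmax hcase
    have d1 : n + i < W := by omega
    have d2 : 1 < W := by omega
    simp only [wp_ite, Test.Holds, wp_block_nil, wp_block_cons, wp_op, wp_load, wp_store, Op.eval,
      hR₂.reg0, hR₂.reg4, hR₂.reg5, f6, f7, f10, State.setReg_reg, State.setReg_bank,
      State.setCell_reg, State.setCell_bank, if_true, if_false, Nat.reduceEqDiff]
    refine ⟨fun h14 => ⟨d1, d2, by omega, ?_⟩, fun h14 => ?_⟩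
    · refine hI.open_new (by omega) fun a han hfa => ?_
      have h1 := hmax a han hfa
      rw [hI.flag] at hfa
      split_ifs at hfa with hc
      -- A marked cluster has a positive remainder modulo `P`, hence is nonempty, so the value zero
      -- really means that nothing is marked.
      have h2 : sz a = 0 := by omega
      rw [h2, Nat.zero_mod] at hc
      omega
    · rcases hcase with h | ⟨hlt, hfb, hszb⟩
      · exact absurd h h14
      · have d3 : s'.bank 6 (s₂.reg 15) + 1 < W := by
          have h1 := hI.units _ hlt
          have h2 := Nat.div_le_self (sz (s₂.reg 15)) P
          have h3 := hsz (s₂.reg 15)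
          omega
        refine ⟨by omega, d3, d3, by omega, by omega, ?_⟩
        exact hI.round_up hfb fun a han hfa => by
          rw [hszb]
          exact hmax a han hfa
  · have := h.1
    nlinarith only [this, hn1]

end phases

/-! ## Assigning the points to the units -/

/-- Bank `8` counts at `j * k + c` the points of color `c` placed at label `j`, bank `9` marks the
placed points, and bank `2` holds their labels. -/
def keepStep : Prog := block [
  .op .add 14 23 10, .load 14 1 14, .load 15 0 10, .op .mul 16 14 2, .op .add 16 16 15,
  .load 17 8 16, .load 18 5 15, .op .div 18 18 30, .load 19 6 14, .op .mul 18 19 18,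
  .ite (.lt 17 18) (block [.op .add 17 17 4, .store 8 16 17, .store 2 10 14, .store 9 10 4]) .skip]

/-- Every cluster keeps its points as far as its units have room for them. -/
def keepLoop : Prog := forLoop 10 0 keepStep

/-- The scan does not stop at a success; the mark in bank `9` prevents a second placement. -/
def tryStep : Prog := block [
  .load 14 9 10,
  .ite (.eq 14 5)
    (block [.op .mul 16 11 2, .op .add 16 16 15, .load 17 8 16, .load 19 6 11, .op .mul 19 19 18,
      .ite (.lt 17 19)
        (block [.op .add 17 17 4, .store 8 16 17, .store 2 10 11, .store 9 10 4]) .skip])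
    .skip]

def fillStep : Prog := block [
  .load 15 0 10, .load 18 5 15, .op .div 18 18 30, forLoop 11 33 tryStep]

/-- Every other point goes to the first label with room for its color. -/
def fillLoop : Prog := forLoop 10 0 fillStep

/-- The point `v` is among the first `T (lab v) * p (col v)` ones with its label and color. -/
def Kept (col lab T p : ℕ → ℕ) (v : ℕ) : Prop :=
  Nat.count (fun u => lab u = lab v ∧ col u = col v) v < T (lab v) * p (col v)

/-- The elements of rank below `M` are the first `M` of them. This links the first-come-first-served
loop to the order-free cardinality `card_keep`. -/
theorem count_rank_lt (q : ℕ → Prop) [DecidablePred q] (M n : ℕ) :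
    Nat.count (fun v => q v ∧ Nat.count q v < M) n = min (Nat.count q n) M := by
  induction n with
  | zero => simp
  | succ n ih =>
    rw [Nat.count_succ, Nat.count_succ, ih]
    by_cases hq : q n <;> by_cases hM : Nat.count q n < M <;> simp [hq, hM] <;> omega

theorem count_congr {p q : ℕ → Prop} [DecidablePred p] [DecidablePred q] {n : ℕ}
    (h : ∀ v < n, p v ↔ q v) : Nat.count p n = Nat.count q n :=
  le_antisymm (Nat.count_mono_left fun v hv => (h v hv).1)
    (Nat.count_mono_left fun v hv => (h v hv).2)

theorem count_kept (col lab T p : ℕ → ℕ) (j c n : ℕ) :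
    Nat.count (fun v => Kept col lab T p v ∧ lab v = j ∧ col v = c) n =
      min (Nat.count (fun v => lab v = j ∧ col v = c) n) (T j * p c) := by
  rw [← count_rank_lt]
  refine count_congr fun v _ => ?_
  rw [and_comm]
  refine and_congr_right fun h => ?_
  rw [Kept, h.1, h.2]

theorem index_inj {k j c j' c' : ℕ} (hc : c < k) (hc' : c' < k) (h : j * k + c = j' * k + c') :
    j = j' ∧ c = c' := by
  have h1 : j = j' := by
    have := congrArg (· / k) h
    have hk : 0 < k := by omega
    simpa [Nat.add_div_of_dvd_right, Nat.mul_div_cancel _ hk, Nat.div_eq_of_lt hc,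
      Nat.div_eq_of_lt hc'] using this
  subst h1
  exact ⟨rfl, by omega⟩

theorem update_index {k j c j' c' : ℕ} {cnt : ℕ → ℕ} {x : ℕ} (hc : c < k) (hc' : c' < k) :
    Function.update cnt (j * k + c) x (j' * k + c') =
      if j = j' ∧ c = c' then x else cnt (j' * k + c') := by
  rw [Function.update_apply]
  by_cases h : j = j' ∧ c = c'
  · rw [if_pos h, if_pos (by rw [h.1, h.2])]
  · rw [if_neg h, if_neg fun h' => h ((index_inj hc' hc h').imp Eq.symm Eq.symm)]

theorem count_or_eq {q : ℕ → Prop} [DecidablePred q] {n v : ℕ} (hv : v < n) (hq : ¬ q v) :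
    Nat.count (fun u => q u ∨ u = v) n = Nat.count q n + 1 := by
  induction n with
  | zero => omega
  | succ n ih =>
    rw [Nat.count_succ, Nat.count_succ]
    rcases Nat.lt_succ_iff_lt_or_eq.1 hv with h | rfl
    · rw [ih h]
      have : n ≠ v := by omega
      simp only [this, or_false]
      omega
    · rw [count_congr (q := q) fun u hu => by simp [hu.ne]]
      simp [hq]

/-- A partial assignment: `asg v = 1` marks the assigned points, `out` holds their labels and
`cnt (j * k + c)` counts those with label `j` and color `c`. -/
structure PartialAssignment (n k : ℕ) (col lab T p asg out cnt : ℕ → ℕ) : Prop where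
  asg_le : ∀ v, asg v = 0 ∨ asg v = 1
  out_lt : ∀ v < n, asg v = 1 → out v < 2 * n
  cnt_eq : ∀ j c, c < k →
    cnt (j * k + c) = Nat.count (fun v => asg v = 1 ∧ out v = j ∧ col v = c) n
  cnt_le : ∀ j c, c < k → cnt (j * k + c) ≤ T j * p c
  kept : ∀ v < n, Kept col lab T p v → asg v = 1 ∧ out v = lab v

section assign

variable {W n k base : ℕ} {col lab L T p asg out cnt : ℕ → ℕ} {s : State}

theorem PartialAssignment.assign (h : PartialAssignment n k col lab T p asg out cnt) {v j : ℕ}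
    (hv : v < n) (hj : j < 2 * n) (hasg : asg v = 0) (hcol : col v < k)
    (hroom : cnt (j * k + col v) < T j * p (col v)) :
    PartialAssignment n k col lab T p (Function.update asg v 1) (Function.update out v j)
      (Function.update cnt (j * k + col v) (cnt (j * k + col v) + 1)) := by
  refine ⟨fun u => ?_, fun u hu hu1 => ?_, fun i c hc => ?_, fun i c hc => ?_, fun u hu hk => ?_⟩
  · rw [Function.update_apply]
    split_ifs
    · exact .inr rfl
    · exact h.asg_le u
  · rw [Function.update_apply] at hu1 ⊢
    split_ifs at hu1 ⊢ with huv
    · exact hj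
    · exact h.out_lt u hu hu1
  · rw [update_index hcol hc]
    split_ifs with hjc
    · obtain ⟨rfl, rfl⟩ := hjc
      rw [h.cnt_eq _ _ hc, ← count_or_eq hv (by simp [hasg])]
      refine count_congr fun u _ => ?_
      by_cases huv : u = v
      · subst huv
        simp
      · simp [huv]
    · rw [h.cnt_eq _ _ hc]
      refine count_congr fun u _ => ?_
      by_cases huv : u = v
      · subst huv
        simpa [hasg] using hjc
      · simp [huv]
  · rw [update_index hcol hc]
    split_ifs with hjc
    · obtain ⟨rfl, rfl⟩ := hjc
      omega
    · exact h.cnt_le i c hc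
  · have h1 := h.kept u hu hk
    have huv : u ≠ v := fun huv => by
      rw [huv, hasg] at h1
      omega
    rw [Function.update_of_ne huv, Function.update_of_ne huv]
    exact h1

theorem count_eq_sum_count {q : ℕ → Prop} [DecidablePred q] {f : ℕ → ℕ} {n N : ℕ}
    (hf : ∀ v < n, q v → f v < N) :
    Nat.count q n = ∑ j ∈ range N, Nat.count (fun v => q v ∧ f v = j) n := by
  simp_rw [Nat.count_eq_card_filter_range]
  rw [Finset.card_eq_sum_card_fiberwise (f := f) (t := range N) fun v hv => by
    simp only [coe_filter, mem_range, Set.mem_ofPred_eq] at hv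
    simpa using hf v hv.1 hv.2]
  simp [Finset.filter_filter]

theorem PartialAssignment.sum_cnt (h : PartialAssignment n k col lab T p asg out cnt) {c : ℕ}
    (hc : c < k) : ∑ j ∈ range (2 * n), cnt (j * k + c) =
      Nat.count (fun v => asg v = 1 ∧ col v = c) n := by
  rw [count_eq_sum_count (f := out) (N := 2 * n) fun v hv hq => h.out_lt v hv hq.1]
  refine Finset.sum_congr rfl fun j _ => ?_
  rw [h.cnt_eq j c hc]
  exact count_congr fun v _ => by tauto

/-- An unassigned point finds a label with room for its color. -/
theorem PartialAssignment.exists_room (h : PartialAssignment n k col lab T p asg out cnt) {v : ℕ}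
    (hv : v < n) (hasg : asg v = 0) (hcol : col v < k)
    (hsum : (∑ j ∈ range (2 * n), T j) * p (col v) = Nat.count (fun u => col u = col v) n) :
    ∃ j < 2 * n, cnt (j * k + col v) < T j * p (col v) := by
  by_contra! hno
  have h1 := Finset.sum_le_sum fun j hj => hno j (mem_range.1 hj)
  rw [← Finset.sum_mul, hsum, h.sum_cnt hcol] at h1
  -- If every label were full, the assigned points of this color would exhaust its class, although
  -- `v` belongs to the class and is unassigned.
  have h2 : Nat.count (fun u => (asg u = 1 ∧ col u = col v) ∨ u = v) n ≤
      Nat.count (fun u => col u = col v) n := Nat.count_mono_left fun u _ hu => by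
    rcases hu with hu | rfl
    · exact hu.2
    · rfl
  rw [count_or_eq hv (by simp [hasg])] at h2
  omega

/-- When all points are assigned, all labels are filled exactly. -/
theorem PartialAssignment.count_eq (h : PartialAssignment n k col lab T p asg out cnt)
    (hasg : ∀ v < n, asg v = 1) {c j : ℕ} (hc : c < k) (hj : j < 2 * n)
    (hsum : (∑ j ∈ range (2 * n), T j) * p c = Nat.count (fun u => col u = c) n) :
    Nat.count (fun v => out v = j ∧ col v = c) n = T j * p c := by
  have h1 := h.sum_cnt hc
  rw [count_congr (q := fun u => col u = c) fun u hu => by simp [hasg u hu], ← hsum,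
    Finset.sum_mul] at h1
  -- Counts bounded termwise by the capacities and with the same total agree with them termwise.
  rw [← (Finset.sum_eq_sum_iff_of_le fun i _ => h.cnt_le i c hc).1 h1 j (mem_range.2 hj),
    h.cnt_eq j c hc]
  exact count_congr fun v hv => by simp [hasg v hv]

theorem keepLoop_wp {cc : ℕ → ℕ} {N : ℕ} (hS : Setting W n k base col lab L)
    (hR : Ready n k base col L s) (h5 : s.bank 5 = cc) (hcc : ∀ c, cc c ≤ n) (h30 : s.reg 30 = N)
    (h6 : s.bank 6 = T) (hT : ∀ j < n, T j ≤ n) (h8 : ∀ a, s.bank 8 a = 0)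
    (h9 : ∀ a, s.bank 9 a = 0) :
    WP W keepLoop s (fun t s' => t ≤ 34 * n ∧
      PartialAssignment n k col lab T (fun c => cc c / N) (s'.bank 9) (s'.bank 2) (s'.bank 8)) := by
  have hb := hS.bound
  set p : ℕ → ℕ := fun c => cc c / N with hp
  refine (wp_forLoop (L := n) (M := n) (τ := 30) (fun i s' =>
      (∀ v, s'.bank 9 v = if v < i ∧ Kept col lab T p v then 1 else 0) ∧
      (∀ v < i, Kept col lab T p v → s'.bank 2 v = lab v) ∧
      ∀ j c, c < k → s'.bank 8 (j * k + c) =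
        min (Nat.count (fun v => lab v = j ∧ col v = c) i) (T j * p c))
      hR.reg0 hR.reg4 (by omega) le_rfl
      hS.n_pos (by decide) (by decide) (by decide) (by simp) (by simp [h8, h9]) ?_).mono ?_
  · intro i s' hi hr ha ⟨hI9, hI2, hI8⟩
    have hR' := hR.of_agree ha (by decide) (by decide)
    have g5 := (ha.bank 5 (by decide)).trans h5
    have g6 := (ha.bank 6 (by decide)).trans h6
    have g30 := (ha.reg 30 (by decide)).trans h30
    have e1 : L (base + i) = lab i := (hS.lab_eq i).symm
    have b1 := hS.lab_lt i hi
    have b2 := hS.col_lt i hi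
    have b3 := hS.base_lt
    have b4 := hT _ b1
    have b5 := hcc (col i)
    have b6 : p (col i) ≤ n := (Nat.div_le_self _ _).trans b5
    have b7 : T (lab i) * p (col i) ≤ n * n := Nat.mul_le_mul b4 b6
    have b8 : lab i * k + col i < 2 * n * k := mul_add_lt_mul (by omega) b2
    have c1 := Nat.count_le (p := fun v => lab v = lab i ∧ col v = col i) (n := i)
    have hx := hI8 (lab i) (col i) b2
    have hx' := Nat.min_le_left (Nat.count (fun v => lab v = lab i ∧ col v = col i) i)
      (T (lab i) * p (col i))
    rw [← hx] at hx'
    have e2 : cc (col i) / N = p (col i) := rfl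
    have d1 : base + i < W := by omega
    have d2 : lab i < W := by omega
    have d3 : col i < W := by omega
    have d4 : lab i * k + col i < W := by omega
    have d5 : lab i * k < W := by omega
    have d6 : s'.bank 8 (lab i * k + col i) + 1 < W := by omega
    have d7 : cc (col i) < W := by omega
    have d8 : p (col i) < W := by omega
    have d9 : T (lab i) < W := by omega
    have d10 : T (lab i) * p (col i) < W := by omega
    have d11 : 1 < W := by omega
    simp [keepStep, Op.eval, Test.Holds, hR'.reg2, hR'.reg4, hR'.reg23, hR'.bank1, hr, e1, e2,
      hR'.bank0 i hi, g5, g6, g30, d1, d2, d3, d4, d5, d6, d7, d8, d9, d10, d11,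
      Nat.lt_of_succ_lt d6, -Order.lt_add_one_iff]
    -- The counter is the minimum of rank and capacity, so testing for room is the same as testing
    -- the rank.
    have hkept : Kept col lab T p i ↔
        s'.bank 8 (lab i * k + col i) < T (lab i) * p (col i) := by
      rw [hx, Kept]
      omega
    have hcount (j c : ℕ) : Nat.count (fun v => lab v = j ∧ col v = c) (i + 1) =
        Nat.count (fun v => lab v = j ∧ col v = c) i + if lab i = j ∧ col i = c then 1 else 0 :=
      Nat.count_succ _ _
    rw [← not_lt, ← hkept]
    refine ⟨fun hk => ⟨fun v => ?_, fun v hv hkv => ?_, fun j c hc => ?_⟩,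
      fun hk => ⟨fun v => ?_, fun v hv hkv => ?_, fun j c hc => ?_⟩⟩
    · rw [Function.update_apply, hI9]
      rcases lt_trichotomy v i with h | rfl | h
      · simp [h, Nat.lt_succ_of_lt h, h.ne, -Order.lt_add_one_iff]
      · simp [hk]
      · rw [if_neg (by omega), if_neg (by omega), if_neg (by omega)]
    · rw [Function.update_apply]
      split_ifs with hvi
      · rw [hvi]
      · exact hI2 v (by omega) hkv
    · rw [update_index b2 hc, hcount]
      rw [hkept] at hk
      split_ifs with hjc
      · obtain ⟨rfl, rfl⟩ := hjc
        omega
      · rw [hI8 j c hc, add_zero]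
    · rw [hI9]
      rcases lt_trichotomy v i with h | rfl | h
      · simp [h, Nat.lt_succ_of_lt h, -Order.lt_add_one_iff]
      · simp [hk]
      · rw [if_neg (by omega), if_neg (by omega)]
    · rcases Nat.lt_succ_iff_lt_or_eq.1 hv with h | rfl
      · exact hI2 v h hkv
      · exact absurd hkv hk
    · rw [hcount, hI8 j c hc]
      rw [hkept] at hk
      split_ifs with hjc
      · obtain ⟨rfl, rfl⟩ := hjc
        omega
      · rw [add_zero]
  · rintro t s' ⟨ht, ⟨hI9, hI2, hI8⟩, -⟩
    refine ⟨ht, ⟨fun v => ?_, fun v hv h1 => ?_, fun j c hc => ?_, fun j c hc => ?_,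
      fun v hv hk => ⟨?_, hI2 v hv hk⟩⟩⟩
    · rw [hI9]
      split_ifs <;> simp
    · rw [hI9] at h1
      split_ifs at h1 with hk
      rw [hI2 v hv hk.2]
      have := hS.lab_lt v hv
      omega
    · rw [hI8 j c hc, ← count_kept]
      refine count_congr fun v hv => ?_
      rw [hI9]
      by_cases hk : Kept col lab T p v
      · simp [hk, hv, hI2 v hv hk]
      · simp [hk]
    · rw [hI8 j c hc]
      exact Nat.min_le_right _ _
    · rw [hI9, if_pos ⟨hv, hk⟩]

/-- Trying all labels for the point `v` leaves it assigned. -/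
theorem tryLoop_wp {v : ℕ} (hS : Setting W n k base col lab L)
    (hR : Ready n k base col L s) (hv : v < n) (h10 : s.reg 10 = v) (h15 : s.reg 15 = col v)
    (h18 : s.reg 18 = p (col v)) (hp : p (col v) ≤ n) (h33 : s.reg 33 = 2 * n)
    (h6 : s.bank 6 = T) (hT : ∀ j < 2 * n, T j ≤ n)
    (h : PartialAssignment n k col lab T p (s.bank 9) (s.bank 2) (s.bank 8))
    (hsum : (∑ j ∈ range (2 * n), T j) * p (col v) = Nat.count (fun u => col u = col v) n) :
    WP W (forLoop 11 33 tryStep) s (fun t s' => t ≤ 24 * (2 * n) ∧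
      PartialAssignment n k col lab T p (s'.bank 9) (s'.bank 2) (s'.bank 8) ∧
      s'.bank 9 v = 1 ∧ ∀ u, s.bank 9 u = 1 → s'.bank 9 u = 1) := by
  have hb := hS.bound
  have hn1 := hS.n_pos
  have hcol := hS.col_lt v hv
  refine (wp_forLoop (L := 2 * n) (M := 2 * n) (τ := 20) (fun j s' =>
      PartialAssignment n k col lab T p (s'.bank 9) (s'.bank 2) (s'.bank 8) ∧
      (∀ u, s.bank 9 u = 1 → s'.bank 9 u = 1) ∧
      (s'.bank 9 v = 0 → ∀ i < j, T i * p (col v) ≤ s'.bank 8 (i * k + col v)))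
      h33 hR.reg4 (by omega) le_rfl
      (by omega) (by decide) (by decide) (by decide) (by simp) (by simpa using h) ?_).mono ?_
  · intro j s' hj hr ha ⟨hA, hmono, hI⟩
    have hR' := hR.of_agree ha (by decide) (by decide)
    have g6 := (ha.bank 6 (by decide)).trans h6
    have g10 := (ha.reg 10 (by decide)).trans h10
    have g15 := (ha.reg 15 (by decide)).trans h15
    have g18 := (ha.reg 18 (by decide)).trans h18
    have b1 := hT j hj
    have b2 : T j * p (col v) ≤ n * n := Nat.mul_le_mul b1 hp
    have b3 : j * k + col v < 2 * n * k := mul_add_lt_mul hj hcol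
    have b4 := hA.cnt_le j (col v) hcol
    have b5 := hA.asg_le v
    have d1 : s'.bank 9 v < W := by omega
    have d2 : j * k + col v < W := by omega
    have d3 : j * k < W := by omega
    have d4 : s'.bank 8 (j * k + col v) + 1 < W := by omega
    have d5 : T j < W := by omega
    have d6 : T j * p (col v) < W := by omega
    have d7 : j < W := by omega
    have d8 : 1 < W := by omega
    simp [tryStep, Op.eval, Test.Holds, hR'.reg2, hR'.reg4, hR'.reg5, hr, g6, g10, g15, g18,
      d1, d2, d3, d4, d5, d6, d7, d8, Nat.lt_of_succ_lt d4, -Order.lt_add_one_iff]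
    refine ⟨fun h0 => ⟨fun hroom => ⟨hA.assign hv hj h0 hcol hroom, fun u hu => ?_⟩,
      fun hfull => ⟨hA, hmono, fun _ i hi => ?_⟩⟩, fun h1 => ⟨hA, hmono, fun h0 => absurd h0 h1⟩⟩
    · rw [Function.update_apply]
      split_ifs
      · rfl
      · exact hmono u hu
    · rcases Nat.lt_succ_iff_lt_or_eq.1 hi with hi | rfl
      · exact hI h0 i hi
      · exact hfull
  · rintro t s' ⟨ht, ⟨hA, hmono, hI⟩, -⟩
    -- By the invariant, an unassigned `v` would have found all `2 * n` labels full, against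
    -- `exists_room`.
    refine ⟨ht, hA, (hA.asg_le v).resolve_left fun h0 => ?_, hmono⟩
    obtain ⟨j, hj, hroom⟩ := hA.exists_room hv h0 hcol hsum
    have := hI h0 j hj
    omega

theorem fillLoop_wp {cc : ℕ → ℕ} {N : ℕ} (hS : Setting W n k base col lab L)
    (hR : Ready n k base col L s) (h5 : s.bank 5 = cc) (hcc : ∀ c, cc c ≤ n) (h30 : s.reg 30 = N)
    (h33 : s.reg 33 = 2 * n)
    (h6 : s.bank 6 = T) (hT : ∀ j < 2 * n, T j ≤ n)
    (h : PartialAssignment n k col lab T (fun c => cc c / N) (s.bank 9) (s.bank 2) (s.bank 8))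
    (hsum : ∀ v < n, (∑ j ∈ range (2 * n), T j) * (cc (col v) / N) =
      Nat.count (fun u => col u = col v) n) :
    WP W fillLoop s (fun t s' => t ≤ 100 * n ^ 2 ∧
      PartialAssignment n k col lab T (fun c => cc c / N) (s'.bank 9) (s'.bank 2) (s'.bank 8) ∧
      ∀ v < n, s'.bank 9 v = 1) := by
  have hb := hS.bound
  have hn1 := hS.n_pos
  refine (wp_forLoop (L := n) (M := n) (τ := 48 * n + 20) (fun i s' =>
      PartialAssignment n k col lab T (fun c => cc c / N) (s'.bank 9) (s'.bank 2) (s'.bank 8) ∧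
      ∀ v < i, s'.bank 9 v = 1)
      hR.reg0 hR.reg4 (by omega) le_rfl
      hS.n_pos (by decide) (by decide) (by decide) (by simp) (by simpa using h) ?_).mono ?_
  · intro i s' hi hr ha ⟨hA, hI⟩
    have hR' := hR.of_agree ha (by decide) (by decide)
    have g5 := (ha.bank 5 (by decide)).trans h5
    have g6 := (ha.bank 6 (by decide)).trans h6
    have g30 := (ha.reg 30 (by decide)).trans h30
    have g33 := (ha.reg 33 (by decide)).trans h33
    have b2 := hS.col_lt i hi
    have b5 := hcc (col i)
    have b6 : cc (col i) / N ≤ n := (Nat.div_le_self _ _).trans b5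
    have d1 : col i < W := by omega
    have d2 : cc (col i) < W := by omega
    have d3 : cc (col i) / N < W := by omega
    unfold fillStep
    simp only [wp_block_cons, wp_load, wp_op, hr, hR'.bank0 i hi, State.setReg_reg,
      State.setReg_bank, g5, g30, Op.eval, if_true, if_false, Nat.reduceEqDiff, d1, d2, d3,
      true_and]
    set s₁ := ((s'.setReg 15 (col i)).setReg 18 (cc (col i))).setReg 18 (cc (col i) / N) with hs₁
    have hR₁ : Ready n k base col L s₁ :=
      Ready.of_agree (rs := [15, 18]) (bs := []) hR'
        ⟨fun r hr => by simp_all, fun _ _ => rfl⟩ (by decide) (by decide)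
    refine (tryLoop_wp (p := fun c => cc c / N) hS hR₁ hi (by simpa [hs₁])
      (by simp [hs₁]) (by simp [hs₁]) b6 (by simpa [hs₁]) (by simpa [hs₁]) hT (by simpa [hs₁])
      (hsum i hi)).mono ?_
    rintro t s₂ ⟨ht, hA₂, hv₂, hmono⟩
    rw [wp_block_nil]
    refine ⟨by omega, hA₂, fun v hv => ?_⟩
    rcases Nat.lt_succ_iff_lt_or_eq.1 hv with h' | rfl
    · exact hmono v (by simpa [hs₁] using hI v h')
    · exact hv₂
  · rintro t s' ⟨ht, h', -⟩
    exact ⟨by nlinarith only [ht, hn1], h'⟩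

end assign

/-! ## The complete program -/

theorem count_eq_card_fin (q : ℕ → Prop) [DecidablePred q] (n : ℕ) :
    Nat.count q n = #{v : Fin n | q v} := by
  rw [Nat.count_eq_card_filter_range, Finset.card_filter, Finset.card_filter,
    Fin.sum_univ_eq_sum_range (fun v => if q v then 1 else 0)]

/-- The number of units: the greatest common divisor of the sizes of the color classes. -/
structure IsUnitCount (n : ℕ) (col : ℕ → ℕ) (N : ℕ) : Prop where
  pos : 1 ≤ N
  dvd : ∀ c, N ∣ Nat.count (fun v => col v = c) n
  greatest : ∀ d, (∀ v < n, d ∣ Nat.count (fun u => col u = col v) n) → d ∣ N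

theorem IsUnitCount.of_greatest {n N : ℕ} {col : ℕ → ℕ} (hn : 1 ≤ n) (hN : 1 ≤ N)
    (hdvd : ∀ v < n, N ∣ Nat.count (fun u => col u = col v) n)
    (hmax : ∀ d, 1 ≤ d → d ≤ n → (∀ v < n, d ∣ Nat.count (fun u => col u = col v) n) → d ≤ N) :
    IsUnitCount n col N := by
  refine ⟨hN, fun c => ?_, fun d hd => ?_⟩
  · by_cases h : ∃ v < n, col v = c
    · obtain ⟨v, hv, rfl⟩ := h
      exact hdvd v hv
    · rw [Nat.count_iff_forall_not.2 fun v hv hc => h ⟨v, hv, hc⟩]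
      exact dvd_zero N
  -- Greatest in size implies greatest for divisibility: the lcm of `d` and `N` is again a common
  -- divisor, hence equals `N`.
  · have hl (v : ℕ) (hv : v < n) : Nat.lcm d N ∣ Nat.count (fun u => col u = col v) n :=
      Nat.lcm_dvd (hd v hv) (hdvd v hv)
    have hpos : 0 < Nat.count (fun u => col u = col 0) n :=
      Nat.pos_of_ne_zero (Nat.count_ne_iff_exists.2 ⟨0, hn, rfl⟩)
    have h1 : Nat.lcm d N ≤ n := (Nat.le_of_dvd hpos (hl 0 hn)).trans (Nat.count_le _)
    have h2 : 1 ≤ Nat.lcm d N := Nat.pos_of_dvd_of_pos (hl 0 hn) hpos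
    have h3 := hmax _ h2 h1 hl
    have h4 : Nat.lcm d N = N := le_antisymm h3 (Nat.le_of_dvd h2 (Nat.dvd_lcm_right d N))
    rw [← h4]
    exact Nat.dvd_lcm_left d N

theorem IsUnitCount.dvd_card {n k N : ℕ} {col : ℕ → ℕ} (h : IsUnitCount n col N)
    (hcol : ∀ v < n, col v < k) : N ∣ n := by
  have h1 := count_eq_sum_count (q := fun _ => True) (f := col) (N := k) (n := n)
    fun v hv _ => hcol v hv
  rw [Nat.count_true] at h1
  nth_rewrite 1 [h1]
  refine Finset.dvd_sum fun c _ => ?_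
  simpa using h.dvd c

theorem sum_count_lab {n : ℕ} {lab : ℕ → ℕ} (hlab : ∀ v < n, lab v < n) :
    ∑ a ∈ range n, Nat.count (fun v => lab v = a) n = n := by
  have h1 := count_eq_sum_count (q := fun _ => True) (f := lab) (N := n) (n := n)
    fun v hv _ => hlab v hv
  rw [Nat.count_true] at h1
  simpa using h1.symm

/-- Ensures that the truncated subtraction computing the number of remaining units is exact. -/
theorem sum_div_le {n N P : ℕ} {sz : ℕ → ℕ} (hP : 0 < P) (hn : N * P = n)
    (hsum : ∑ a ∈ range n, sz a = n) : ∑ a ∈ range n, sz a / P ≤ N := by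
  refine Nat.le_of_mul_le_mul_right ?_ hP
  rw [hn, Finset.sum_mul]
  exact (Finset.sum_le_sum fun a _ => Nat.div_mul_le_self _ _).trans hsum.le

theorem greedyRounding_of_assignment {n k N P i : ℕ} {color : Fin n → Fin k}
    {col lab T fl asg out cnt : ℕ → ℕ} (hcol : ∀ v : Fin n, col v = color v)
    (hlab : ∀ v < n, lab v < n) (hN : IsUnitCount n col N) (hP : 0 < P) (hn : N * P = n)
    (hT : PartialRounding n P (fun a => Nat.count (fun v => lab v = a) n) T fl i)
    (hsum : ∑ j ∈ range (2 * n), T j = N)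
    (hA : PartialAssignment n k col lab T (fun c => Nat.count (fun v => col v = c) n / N)
      asg out cnt) (hasg : ∀ v < n, asg v = 1) :
    GreedyRounding color (fun v => lab v) N P
      (fun c => Nat.count (fun v => col v = c) n / N) T (fun v => Kept col lab T
        (fun c => Nat.count (fun v => col v = c) n / N) v) (fun v => out v) := by
  have hp (c : ℕ) : N * (Nat.count (fun v => col v = c) n / N) =
      Nat.count (fun v => col v = c) n := Nat.mul_div_cancel' (hN.dvd c)
  have hc (v : Fin n) (c : Fin k) : color v = c ↔ col v = c := by rw [hcol, Fin.ext_iff]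
  have hsz (j : ℕ) : #{v : Fin n | lab v = j} = Nat.count (fun v => lab v = j) n :=
    (count_eq_card_fin (fun v => lab v = j) n).symm
  refine ⟨hP, hN.pos, hn, fun c => ?_, fun v => hlab v v.2, fun v => hA.out_lt v v.2 (hasg v v.2),
    fun v hv => (hA.kept v v.2 hv).2, fun j hj c => ?_, fun j hj c => ?_, ?_, hT.units_new, hsum,
    ?_, ?_⟩
  · rw [hp, count_eq_card_fin]
    simp only [hc]
  · simp only [hc]
    rw [← count_eq_card_fin fun v => lab v = j ∧ col v = c, ← count_kept col lab T
      (fun c => Nat.count (fun v => col v = c) n / N) j c n, count_eq_card_fin]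
    congr 1
    ext v
    simp [and_assoc]
  · simp only [hc]
    rw [← count_eq_card_fin fun v => out v = j ∧ col v = c]
    exact hA.count_eq hasg c.2 hj (by rw [hsum, hp])
  · simpa only [hsz] using hT.units
  · simpa only [hsz] using hT.greedy
  · simpa only [hsz] using hT.greedy_new

/-- Rounds the clustering whose index is in register `22` to a fair one. -/
def rounding : Prog := block [
  .op .mul 23 22 0, countLoop, gcdLoop, quotLoop, roundLoop, keepLoop, fillLoop]

theorem rounding_wp {W n k base : ℕ} {color : Fin n → Fin k} {col lab L : ℕ → ℕ} {s : State}
    (hS : Setting W n k base col lab L) (hR : Ready n k base col L (s.setReg 23 base))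
    (hbase : s.reg 22 * n = base) (hcol : ∀ v : Fin n, col v = color v)
    (hz : ∀ b ∈ [4, 5, 6, 7, 8, 9], ∀ a, s.bank b a = 0) :
    WP W rounding s (fun t s' => t ≤ 1000 * n ^ 2 ∧ ∃ N P p T keep, IsUnitCount n col N ∧
      GreedyRounding color (fun v => lab v) N P p T keep (fun v => s'.bank 2 v)) := by
  have hn1 := hS.n_pos
  have hbl := hS.base_lt
  have hreg0 : s.reg 0 = n := by simpa using hR.reg0
  set sz : ℕ → ℕ := fun a => Nat.count (fun v => lab v = a) n with hsz
  set cc : ℕ → ℕ := fun c => Nat.count (fun v => col v = c) n with hcc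
  have hszn (a : ℕ) : sz a ≤ n := Nat.count_le _
  have hccn (c : ℕ) : cc c ≤ n := Nat.count_le _
  unfold rounding
  rw [wp_block_cons, wp_op]
  simp only [Op.eval, hreg0, hbase]
  refine ⟨by omega, ?_⟩
  rw [wp_block_cons]
  refine (countLoop_wp hS hR (hz 4 (by decide)) (hz 5 (by decide))).frame.mono ?_
  rintro t₁ s₁ ⟨⟨ht₁, h4, h5⟩, ha₁⟩
  have hR₁ := hR.of_agree ha₁ (by decide) (by decide)
  have h4 : s₁.bank 4 = sz := funext h4
  have h5 : s₁.bank 5 = cc := funext h5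
  rw [wp_block_cons]
  refine (gcdLoop_wp hS hR₁ h5 hccn).frame.mono ?_
  rintro t₂ s₂ ⟨⟨ht₂, hN1, hNd, hNm⟩, ha₂⟩
  have hR₂ := hR₁.of_agree ha₂ (by decide) (by decide)
  set N := s₂.reg 30 with hN
  have hNu : IsUnitCount n col N := .of_greatest hn1 hN1 hNd hNm
  have hNn : N ∣ n := hNu.dvd_card hS.col_lt
  have hNle : N ≤ n := Nat.le_of_dvd hn1 hNn
  have hP : 0 < n / N := Nat.div_pos hNle hN1
  have hNP : N * (n / N) = n := Nat.mul_div_cancel' hNn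
  have h4₂ : s₂.bank 4 = sz := (ha₂.bank 4 (by decide)).trans h4
  have z (b : ℕ) (hb : b ∈ [4, 5, 6, 7, 8, 9]) (h₁ : b ∉ countLoop.wbanks)
      (h₂ : b ∉ gcdLoop.wbanks) (a : ℕ) : s₂.bank b a = 0 := by
    rw [ha₂.bank b h₂, ha₁.bank b h₁]
    exact hz b hb a
  rw [wp_block_cons]
  refine (quotLoop_wp hS hR₂ h4₂ hszn (z 6 (by decide) (by decide) (by decide))
    (z 7 (by decide) (by decide) (by decide)) rfl hNle).frame.mono ?_
  rintro t₃ s₃ ⟨⟨ht₃, -, h33, h32, h6, h7⟩, ha₃⟩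
  have hR₃ := hR₂.of_agree ha₃ (by decide) (by decide)
  have h4₃ : s₃.bank 4 = sz := (ha₃.bank 4 (by decide)).trans h4₂
  rw [← hN] at h32 h6 h7
  have hround : PartialRounding n (n / N) sz (s₃.bank 6) (s₃.bank 7) 0 := by
    have h6' (a : ℕ) (ha : a < n) : s₃.bank 6 a = sz a / (n / N) := by rw [h6, if_pos ha]
    have h6n (a : ℕ) (ha : n ≤ a) : s₃.bank 6 a = 0 := by rw [h6, if_neg (by omega)]
    refine ⟨fun a => ?_, fun a ha => .inl (h6' a ha), fun j hj => by simp [h6n j hj],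
      fun j hj => h6n j hj, ?_, fun a _ b hb _ _ hTb => ?_, fun a _ _ _ j hj => h6n j hj⟩
    · rw [h7]
      refine if_congr (and_congr_right fun ha => ?_) rfl rfl
      simp [h6' a ha]
    · rw [two_mul, Finset.sum_range_add, Finset.sum_congr rfl fun a ha => h6' a (mem_range.1 ha)]
      simp [h6n]
    · rw [h6' b hb] at hTb
      omega
  have hRle : N - ∑ a ∈ range n, sz a / (n / N) ≤ n := (Nat.sub_le _ _).trans hNle
  rw [wp_block_cons]
  refine (roundLoop_wp hS hR₃ h4₃ hszn hP h32 hRle hround).frame.mono ?_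
  rintro t₄ s₄ ⟨⟨ht₄, hT⟩, ha₄⟩
  have hR₄ := hR₃.of_agree ha₄ (by decide) (by decide)
  have hsumT : ∑ j ∈ range (2 * n), s₄.bank 6 j = N := by
    rw [hT.sum_units]
    have := sum_div_le hP hNP (sum_count_lab hS.lab_lt)
    simp only [hsz]
    omega
  have hTn (j : ℕ) (hj : j < 2 * n) : s₄.bank 6 j ≤ n := by
    refine le_trans ?_ hNle
    rw [← hsumT]
    exact Finset.single_le_sum (f := s₄.bank 6) (fun _ _ => Nat.zero_le _) (mem_range.2 hj)
  have h5₄ : s₄.bank 5 = cc := by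
    rw [ha₄.bank 5 (by decide), ha₃.bank 5 (by decide), ha₂.bank 5 (by decide), h5]
  have h30₄ : s₄.reg 30 = N := by rw [ha₄.reg 30 (by decide), ha₃.reg 30 (by decide)]
  have h33₄ : s₄.reg 33 = 2 * n := by rw [ha₄.reg 33 (by decide), h33]
  have z₄ (b : ℕ) (hb : b ∈ [8, 9]) (a : ℕ) : s₄.bank b a = 0 := by
    rw [ha₄.bank b (by revert b; decide), ha₃.bank b (by revert b; decide)]
    exact z b (by revert b; decide) (by revert b; decide) (by revert b; decide) a
  rw [wp_block_cons]
  refine (keepLoop_wp hS hR₄ h5₄ hccn h30₄ rfl (fun j hj => hTn j (by omega))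
    (z₄ 8 (by decide)) (z₄ 9 (by decide))).frame.mono ?_
  rintro t₅ s₅ ⟨⟨ht₅, hA₅⟩, ha₅⟩
  have hR₅ := hR₄.of_agree ha₅ (by decide) (by decide)
  rw [wp_block_cons]
  refine (fillLoop_wp hS hR₅ ((ha₅.bank 5 (by decide)).trans h5₄) hccn
    ((ha₅.reg 30 (by decide)).trans h30₄) ((ha₅.reg 33 (by decide)).trans h33₄)
    (ha₅.bank 6 (by decide)) hTn hA₅ fun v _ => ?_).mono ?_
  · rw [hsumT]
    exact Nat.mul_div_cancel' (hNu.dvd _)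
  · rintro t₆ s₆ ⟨ht₆, hA₆, hasg⟩
    rw [wp_block_nil]
    refine ⟨?_, N, n / N, _, s₄.bank 6, _, hNu,
      greedyRounding_of_assignment hcol hS.lab_lt hNu hP hNP hT hsumT hA₆ hasg⟩
    have : n ≤ n ^ 2 := Nat.le_self_pow two_ne_zero n
    omega

/-- The whole algorithm. -/
def fairConsensus : Prog := block [.const 4 1, median, rounding]

/-! ### From the input encoding to clusterings, and the whole program -/

theorem inputState_bank_one {n m k ℓ : ℕ} (color : Fin n → Fin k) (lab : Fin m → Fin n → Fin n)
    (i : Fin m) (v : Fin n) : (inputState ℓ color lab).bank 1 (i * n + v) = lab i v := by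
  have h := mul_add_lt_mul i.2 v.2
  have h1 : (⟨i * n + v, h⟩ : Fin (m * n)) = finProdFinEquiv (i, v) := by
    apply Fin.ext
    simp only [finProdFinEquiv_apply_val]
    ring
  have h2 : finProdFinEquiv.symm (⟨i * n + v, h⟩ : Fin (m * n)) = (i, v) := by
    rw [h1, Equiv.symm_apply_apply]
  simp [inputState, h, h2, -finProdFinEquiv_symm_apply]

theorem labelDist_eq {n m k ℓ : ℕ} (color : Fin n → Fin k) {C : Fin m → Clustering n}
    {lab : Fin m → Fin n → Fin n} (hlab : ∀ i, Represents (fun v => (lab i v : ℕ)) (C i))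
    (i j : Fin m) :
    labelDist ((inputState ℓ color lab).bank 1) n i j = 2 * dist (C i) (C j) := by
  rw [two_mul_dist (hlab i) (hlab j), labelDist, ← Fin.sum_univ_eq_sum_range (fun u =>
    ∑ v ∈ range n, pairCost ((inputState ℓ color lab).bank 1) n i j u v)]
  refine Finset.sum_congr rfl fun u _ => ?_
  rw [← Fin.sum_univ_eq_sum_range (fun v =>
    pairCost ((inputState ℓ color lab).bank 1) n i j u v), disagree, Finset.card_filter]
  refine Finset.sum_congr rfl fun v _ => ?_
  simp only [pairCost, inputState_bank_one]
  split_ifs <;> simp_all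

theorem totalDist_eq {n m k ℓ : ℕ} (color : Fin n → Fin k) {C : Fin m → Clustering n}
    {lab : Fin m → Fin n → Fin n} (hlab : ∀ i, Represents (fun v => (lab i v : ℕ)) (C i))
    (i : Fin m) :
    totalDist ((inputState ℓ color lab).bank 1) n m i = 2 * ∑ j, dist (C i) (C j) := by
  rw [totalDist, ← Fin.sum_univ_eq_sum_range (fun j =>
    labelDist ((inputState ℓ color lab).bank 1) n i j), Finset.mul_sum]
  exact Finset.sum_congr rfl fun j _ => labelDist_eq color hlab i j

/-- All numbers that occur are smaller than the sixth power of the input size. -/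
theorem word_bounds {n m k ℓ : ℕ} (hn : 1 ≤ n) (hm : 1 ≤ m) (hk : 1 ≤ k) (hℓ : 1 ≤ ℓ) :
    m * (n * n) + 1 < (n + m + k + ℓ) ^ 6 ∧
      2 * n * k + k + n * n + 4 * n + 10 < (n + m + k + ℓ) ^ 6 := by
  obtain ⟨X, hX⟩ : ∃ X, X = n + m + k + ℓ := ⟨_, rfl⟩
  rw [← hX]
  -- All four parameters are positive; the three extra factors `X` give a factor 64, which absorbs
  -- the constants.
  have h4 : 4 ≤ X := by omega
  have a1 : n * n ≤ X * X := Nat.mul_le_mul (by omega) (by omega)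
  have a2 : n * k ≤ X * X := Nat.mul_le_mul (by omega) (by omega)
  have a3 : m * (n * n) ≤ X * (X * X) := Nat.mul_le_mul (by omega) a1
  have b1 : 4 * X ≤ X * X := Nat.mul_le_mul_right _ h4
  have b2 : 4 * (X * X) ≤ X * (X * X) := Nat.mul_le_mul_right _ h4
  have b3 : 64 * (X * (X * X)) ≤ X ^ 6 := by
    calc 64 * (X * (X * X)) = 4 ^ 3 * (X * (X * X)) := by norm_num
      _ ≤ X ^ 3 * (X * (X * X)) := Nat.mul_le_mul_right _ (Nat.pow_le_pow_left h4 3)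
      _ = X ^ 6 := by ring
  rw [Nat.mul_assoc]
  constructor <;> omega

theorem fairConsensus_wp {n m k ℓ : ℕ} (hn : 1 ≤ n) (hm : 1 ≤ m) (hℓ : 1 ≤ ℓ)
    (color : Fin n → Fin k) {C : Fin m → Clustering n} {lab : Fin m → Fin n → Fin n}
    (hlab : ∀ i, Represents (fun v => (lab i v : ℕ)) (C i)) :
    WP ((n + m + k + ℓ) ^ 6) fairConsensus (inputState ℓ color lab) (fun t s =>
      t ≤ 2000 * (m ^ 2 * n ^ 2) ∧ ∃ i : Fin m,
        (∀ i', ∑ j, dist (C i) (C j) ≤ ∑ j, dist (C i') (C j)) ∧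
        ∃ N P p T keep, (∀ d, (∀ c, d ∣ #{v | color v = c}) → d ∣ N) ∧
          GreedyRounding color (fun v => (lab i v : ℕ)) N P p T keep (outputLabels n s)) := by
  have hk : 1 ≤ k := Nat.pos_of_ne_zero fun h => by
    subst h
    exact (color ⟨0, hn⟩).elim0
  obtain ⟨hW1, hW2⟩ := word_bounds hn hm hk hℓ
  set W := (n + m + k + ℓ) ^ 6 with hW
  set s := inputState ℓ color lab with hs
  have hL (i : Fin m) (v : Fin n) : s.bank 1 (i * n + v) = lab i v :=
    inputState_bank_one color lab i v
  have hLW (a : ℕ) (ha : a < m * n) : s.bank 1 a < W := by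
    simp only [hs, inputState, ha, dif_pos, if_neg one_ne_zero, if_true]
    have := (lab (finProdFinEquiv.symm ⟨a, ha⟩).1 (finProdFinEquiv.symm ⟨a, ha⟩).2).2
    omega
  unfold fairConsensus
  simp only [wp_block_cons, wp_const]
  refine ⟨by omega, ?_⟩
  refine (median_wp (n := n) (m := m) (L := s.bank 1) (s := s.setReg 4 1)
    (by simp [hs, inputState]) (by simp [hs, inputState]) (by simp) (by simp [hs, inputState]) rfl hm hn hLW hW1).frame.mono ?_
  rintro t₁ s₁ ⟨⟨ht₁, hbm, hbest⟩, ha₁⟩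
  set i : Fin m := ⟨s₁.reg 22, hbm⟩ with hi
  have hbase : s₁.reg 22 * n + n ≤ m * n := by
    have := Nat.mul_le_mul_right n (Nat.succ_le_of_lt hbm)
    rwa [Nat.succ_mul] at this
  have hmn : m * n ≤ m * (n * n) := Nat.mul_le_mul_left _ (Nat.le_mul_of_pos_left _ hn)
  have hcol (v : Fin n) : s.bank 0 v = color v := by simp [hs, inputState]
  have hlab' (v : Fin n) : s.bank 1 (s₁.reg 22 * n + v) = lab i v := hL i v
  have hS : Setting W n k (s₁.reg 22 * n) (s.bank 0) (fun v => s.bank 1 (s₁.reg 22 * n + v))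
      (s.bank 1) := by
    refine ⟨hn, fun v hv => ?_, fun v hv => ?_, fun v => rfl, by omega, hW2⟩
    · rw [show v = ((⟨v, hv⟩ : Fin n) : ℕ) from rfl, hcol]
      exact (color _).2
    · rw [show v = ((⟨v, hv⟩ : Fin n) : ℕ) from rfl, hlab']
      exact (lab _ _).2
  have hz (b : ℕ) (hb : b ∈ [4, 5, 6, 7, 8, 9]) (a : ℕ) : s₁.bank b a = 0 := by
    rw [ha₁.bank b (by revert b; decide)]
    have : b ≠ 0 ∧ b ≠ 1 := by revert b; decide
    simp [hs, inputState, this]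
  have hR : Ready n k (s₁.reg 22 * n) (s.bank 0) (s.bank 1)
      (s₁.setReg 23 (s₁.reg 22 * n)) := by
    refine ⟨?_, ?_, ?_, ?_, by simp, fun v _ => ?_, ?_⟩
    · simpa [hs, inputState] using ha₁.reg 0 (by decide)
    · simpa [hs, inputState] using ha₁.reg 2 (by decide)
    · simpa [hs, inputState] using ha₁.reg 4 (by decide)
    · simpa [hs, inputState] using ha₁.reg 5 (by decide)
    · exact congrFun (ha₁.bank 0 (by decide)) v
    · exact ha₁.bank 1 (by decide)
  refine (rounding_wp hS hR rfl hcol hz).mono ?_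
  rintro t₂ s₂ ⟨ht₂, N, P, p, T, keep, hN, hG⟩
  rw [wp_block_nil]
  refine ⟨?_, i, fun i' => ?_, N, P, p, T, keep, fun d hd => ?_, ?_⟩
  · have h1 : n ^ 2 ≤ m ^ 2 * n ^ 2 := Nat.le_mul_of_pos_left _ (by positivity)
    have h2 : 1 ≤ n ^ 2 := Nat.one_le_pow _ _ hn
    omega
  · have h1 := hbest i' i'.2
    have h2 := totalDist_eq (ℓ := ℓ) color hlab i
    have h3 := totalDist_eq (ℓ := ℓ) color hlab i'
    rw [← hs] at h2 h3
    rw [show s₁.reg 22 = (i : ℕ) from rfl, h2, h3] at h1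
    omega
  · refine hN.greatest d fun v hv => ?_
    have hv' : s.bank 0 v = color ⟨v, hv⟩ := hcol ⟨v, hv⟩
    have h1 := hd (color ⟨v, hv⟩)
    rw [count_eq_card_fin]
    convert h1 using 2
    ext u
    rw [mem_filter, mem_filter, hcol u, hv', Fin.ext_iff]
  · simp only [hlab'] at hG
    exact hG

end FairConsensus

end

/-! ### The main theorem -/

theorem mainTheorem5 :
    ∃ (P : FairConsensus.Prog) (e T : ℕ) (B : ℝ),
      ∀ (n m k ℓ : ℕ), 1 ≤ n → 1 ≤ m → 1 ≤ ℓ →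
      ∀ (color : Fin n → Fin k) (C : Fin m → FairConsensus.Clustering n)
        (lab : Fin m → Fin n → Fin n),
        (∀ i, FairConsensus.Represents (fun v => (lab i v : ℕ)) (C i)) →
        ∃ (t : ℕ) (s : FairConsensus.State) (F : FairConsensus.Clustering n),
          FairConsensus.Exec ((n + m + k + ℓ) ^ e) P
            (FairConsensus.inputState ℓ color lab) t s ∧
          t ≤ T * (m ^ 2 * n ^ 2) ∧
          FairConsensus.Represents (FairConsensus.outputLabels n s) F ∧
          FairConsensus.IsApproxFairConsensus ℓ color C (B * (k : ℝ) ^ (3.8 : ℝ)) F ∧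
          (2 ≤ k → FairConsensus.EqualProportion color →
            FairConsensus.IsApproxFairConsensus ℓ color C
              (B * ((k : ℝ) ^ (1.6 : ℝ) * Real.log k ^ (2.8 : ℝ))) F) := by
  refine ⟨FairConsensus.fairConsensus, 6, 2000, 1000, ?_⟩
  intro n m k ℓ hn hm hℓ color C lab hlab
  obtain ⟨t, s, hexec, ht, i, hi, N, P, p, T, keep, hgcd, hG⟩ :=
    FairConsensus.fairConsensus_wp hn hm hℓ color hlab
  obtain ⟨F, hF⟩ := FairConsensus.exists_represented (FairConsensus.outputLabels n s)
  have hk : 1 ≤ k := Nat.pos_of_ne_zero fun h => by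
    subst h
    exact (color ⟨0, hn⟩).elim0
  have happrox {β : ℝ} (hβ : 176 ≤ β) : FairConsensus.IsApproxFairConsensus ℓ color C β F :=
    FairConsensus.IsApproxFairConsensus.of_median hℓ hm i hi (hG.isFair hF)
      (fun G hfair => hG.dist_le hgcd (hlab i) hF hfair) hβ
  exact ⟨t, s, F, hexec, ht, hF, happrox (FairConsensus.le_mul_rpow_colors hk),
    fun hk2 _ => happrox (FairConsensus.le_mul_rpow_log_colors hk2)⟩
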